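/- **Proposition 1 (Generalized Stokes formulas of the first kind).** Let $\Sigma$ be a compact smooth surface in $\mathbb{R}^3$ with (possibly empty) smooth boundary curve $C$, regularly immersed, with smooth position vector $\mathbf f$ and a continuous unit normal field $\mathbf n$. Let $\boldsymbol\tau$ be the unit tangent of $C$, directed in accordance with $\mathbf n$, i.e. such that $\mathbf n\times\boldsymbol\tau$ points into $\Sigma$. Let $dl$ be the arc length on $C$ and $d\sigma$ the area on $\Sigma$. In local surface coordinates $(x^1,x^2)$ put $\mathbf g_l=\partial\mathbf f/\partial x^l$, let $\mathbf g^1,\mathbf g^2$ be the basis of the tangent plane dual to $\mathbf g_1,\mathbf g_2$ (that is $\mathbf g^l=g^{lk}\mathbf g_k$, where $[g^{lk}]$ is the inverse of the matrix $[\mathbf g_l\cdot\mathbf g_k]$), and let $\nabla^\Sigma=\mathbf g^l\,\partial/\partial x^l$ be the surface gradient operator. For a tensor-valued field $\Phi$ on $\Sigma$ and an operation $\circ$ put $$(\mathbf n\times\nabla^\Sigma)\circ\Phi=\sum_l(\mathbf n\times\mathbf g^l)\circ\frac{\partial\Phi}{\partial x^l},\qquad \Phi\circ(\mathbf n\times\nabla^\Sigma)=\sum_l\frac{\partial\Phi}{\partial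 x^l}\circ(\mathbf n\times\mathbf g^l).$$ Then for every order $p\ge 0$, every continuously differentiable field $\Phi$ of tensors of order $p$ over $\mathbb{R}^3$ that is defined on $\Sigma$ only, and every operation $\circ$ that is bilinear in a vector of $\mathbb{R}^3$ and a tensor of order $p$, with values in a finite-dimensional real vector space (in particular for any tensor product, contraction or vector product), all the integrands below are integrable and $$\oint_C\boldsymbol\tau\circ\Phi\,dl=\int_\Sigma(\mathbf n\times\nabla^\Sigma)\circ\Phi\,d\sigma,$$ and, for operations with the factors in the other order, $$\oint_C\Phi\circ\boldsymbol\tau\,dl=\int_\Sigma\Phi\circ(\mathbf n\times\nabla^\Sigma)\,d\sigma.$$ -/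

import Mathlib

open Set MeasureTheory
open scoped Manifold ContDiff

noncomputable section

/-- Euclidean three-space. -/
abbrev E3 : Type := EuclideanSpace ℝ (Fin 3)

/-- The parameter plane `ℝ²` in which surface coordinates `(x⁰, x¹)` take their values. -/
abbrev E2 : Type := EuclideanSpace ℝ (Fin 2)

/-- Tensors of order `p` over `ℝ³`: `p`-linear forms on `ℝ³` (vectors and covectors being
identified through the Euclidean inner product), with the operator norm. -/
abbrev Tensor (p : ℕ) : Type := ContinuousMultilinearMap ℝ (fun _ : Fin p => E3) ℝ

/-- The vector product of `ℝ³`. -/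
def cross (a b : E3) : E3 := WithLp.toLp 2 (crossProduct a.ofLp b.ofLp)

namespace Surface

section

variable {M : Type*} [TopologicalSpace M] [ChartedSpace (EuclideanHalfSpace 2) M]
  {V : Type*} [NormedAddCommGroup V] [NormedSpace ℝ V]

/-- The partial derivative `∂Φ/∂xˡ` of a field `Φ` on the surface, in the surface coordinates of
the chart around `x`, at the point whose coordinates are `u`. Coordinates range over (an open part
of) the half-plane `x⁰ ≥ 0`; on its edge the derivative is the one from inside the half-plane. -/
def partialDeriv (x : M) (Φ : M → V) (u : E2) (l : Fin 2) : V :=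
  fderivWithin ℝ (Φ ∘ (extChartAt (𝓡∂ 2) x).symm) (range (𝓡∂ 2)) u
    (EuclideanSpace.single l 1)

/-- `∂Φ/∂xˡ` at the point `p`, in the surface coordinates of the chart around `p`. -/
def partialAt (Φ : M → V) (p : M) (l : Fin 2) : V :=
  partialDeriv p Φ (extChartAt (𝓡∂ 2) p p) l

/-- The covariant basis `g_l = ∂f/∂xˡ` of the tangent plane at `p`, where `f` is the position
vector of the surface. -/
def covBasis (f : M → E3) (p : M) (l : Fin 2) : E3 := partialAt f p l

/-- The metric components `g_{lk} = (g_l, g_k)` at `p`. -/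
def metricMatrix (f : M → E3) (p : M) : Matrix (Fin 2) (Fin 2) ℝ :=
  Matrix.of fun l k => inner ℝ (covBasis f p l) (covBasis f p k)

/-- The contravariant (dual) basis `gˡ = gˡᵏ g_k` of the tangent plane at `p`. -/
def contraBasis (f : M → E3) (p : M) (l : Fin 2) : E3 :=
  ∑ k : Fin 2, (metricMatrix f p)⁻¹ l k • covBasis f p k

/-- `f` is the position vector of a regular smooth surface in `ℝ³`: it is smooth and every point is
nonsingular, i.e. the covariant basis vectors are linearly independent. -/
structure IsRegularSurface (f : M → E3) : Prop where
  smooth : ContMDiff (𝓡∂ 2) 𝓘(ℝ, E3) ∞ f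
  nonsingular : ∀ p : M, LinearIndependent ℝ (covBasis f p)

/-- `n` is a continuous unit normal field of the surface. -/
structure IsUnitNormal (f n : M → E3) : Prop where
  continuous : Continuous n
  norm_eq_one : ∀ p : M, ‖n p‖ = 1
  normal : ∀ (p : M) (l : Fin 2), inner ℝ (n p) (covBasis f p l) = 0

/-- `τ` is, along the boundary curve, the unit tangent of this curve, directed in accordance with
the unit normal `n` (right-hand rule): `n × τ` points into the surface. In the chart around a
boundary point the curve is `x⁰ = 0`, so `g_1` spans its tangent line, and a tangent vector
`a g_0 + b g_1` points into the surface if and only if `a > 0`.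
Away from the boundary `τ` is arbitrary. -/
structure IsBoundaryTangent (f n τ : M → E3) : Prop where
  norm_eq_one : ∀ p ∈ (𝓡∂ 2).boundary M, ‖τ p‖ = 1
  tangent : ∀ p ∈ (𝓡∂ 2).boundary M, ∃ c : ℝ, τ p = c • covBasis f p 1
  inward : ∀ p ∈ (𝓡∂ 2).boundary M, ∃ a b : ℝ, 0 < a ∧
    cross (n p) (τ p) = a • covBasis f p 0 + b • covBasis f p 1

/-- The part of the area measure seen by the chart around `x`: the image on the surface of
`|g_0 × g_1| dx⁰ dx¹` on the coordinate domain of this chart. -/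
def chartArea [MeasurableSpace M] (f : M → E3) (x : M) : Measure M :=
  Measure.map (extChartAt (𝓡∂ 2) x).symm
    ((volume.restrict (extChartAt (𝓡∂ 2) x).target).withDensity fun u =>
      ENNReal.ofReal ‖cross (partialDeriv x f u 0) (partialDeriv x f u 1)‖)

/-- The area measure `dσ` of the surface. The measures `chartArea f x` agree on overlaps of charts,
so that their least upper bound is the measure glued from them: on every chart domain it is
`|g_0 × g_1| dx⁰ dx¹`. -/
def areaMeasure [MeasurableSpace M] (f : M → E3) : Measure M := ⨆ x : M, chartArea f x

/-- The part of the arc length measure of the boundary curve seen by the chart around `x`: the image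
of `|g_1| dx¹` on the part `x⁰ = 0` of the coordinate domain of this chart. -/
def chartLength [MeasurableSpace M] (f : M → E3) (x : M) : Measure M :=
  Measure.map (fun t : ℝ => (extChartAt (𝓡∂ 2) x).symm !₂[0, t])
    ((volume.restrict {t : ℝ | !₂[0, t] ∈ (extChartAt (𝓡∂ 2) x).target}).withDensity fun t =>
      ENNReal.ofReal ‖partialDeriv x f !₂[0, t] 1‖)

/-- The arc length measure `dl` of the boundary curve, as a measure on the surface that is carried by
the boundary. As for the area, the measures of the charts agree on overlaps, and their least
upper bound is the measure glued from them. -/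
def lengthMeasure [MeasurableSpace M] (f : M → E3) : Measure M := ⨆ x : M, chartLength f x

variable {W : Type*} [NormedAddCommGroup W] [NormedSpace ℝ W]

/-- `(n × ∇) ∘ Φ = ∑ₗ (n × gˡ) ∘ ∂Φ/∂xˡ`, where `∇ = gˡ ∂/∂xˡ` is the surface gradient operator and
`∘` is the operation `op`. The sum does not depend on the surface coordinates. -/
def crossNablaOp (f n : M → E3) (op : E3 →ₗ[ℝ] V →ₗ[ℝ] W) (Φ : M → V) (p : M) : W :=
  ∑ l : Fin 2, op (cross (n p) (contraBasis f p l)) (partialAt Φ p l)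

/-- `Φ ∘ (n × ∇) = ∑ₗ ∂Φ/∂xˡ ∘ (n × gˡ)`, where `∇ = gˡ ∂/∂xˡ` is the surface gradient operator and
`∘` is the operation `op`. -/
def opCrossNabla (f n : M → E3) (op : V →ₗ[ℝ] E3 →ₗ[ℝ] W) (Φ : M → V) (p : M) : W :=
  ∑ l : Fin 2, op (partialAt Φ p l) (cross (n p) (contraBasis f p l))

end

end Surface

end

/-! In a chart let ε = ±1 be the sign of n · (g_0 × g_1). Since det(g_{lk}) = |g_0 × g_1|², one has
n × g⁰ = ε g_1 / |g_0 × g_1| and n × g¹ = −ε g_0 / |g_0 × g_1| (by `cross_normal_dual`), so the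
surface integrand times the area density is ε(g_1 ∘ ∂_0Φ − g_0 ∘ ∂_1Φ). As ∂_0 g_1 = ∂_1 g_0, this
is the curl ε(∂_0(g_1 ∘ Φ) − ∂_1(g_0 ∘ Φ)) (`curl_chartField`). For a field supported in the chart,
Green's formula on the half-plane x⁰ ≥ 0 (`integral_halfPlane_curl`) turns its integral into −ε ∫
g_1 ∘ Φ dx¹ over the edge. The orientation of τ amounts to |g_1| τ = −ε g_1
(`norm_smul_tangent_eq`), so this is the curve integral.

A partition of unity subordinate to chart pieces on which ε is constant gives the general case
(`stokes_crossNablaOp`). Two things must be freed from the choice of chart. The integrand at a point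
is defined by the chart around that point; `tangentVec_change` carries it to a fixed chart. The
measures are suprema of chart measures; by change of variables they coincide on each chart domain
with the measure of that chart (`areaMeasure_restrict`, `lengthMeasure_restrict`). -/

noncomputable section

/-! ### Vector algebra of the moving frame. -/

section VectorAlgebra

lemma cross_apply_zero (a b : E3) : cross a b 0 = a 1 * b 2 - a 2 * b 1 := by
  simp [cross, cross_apply]

lemma cross_apply_one (a b : E3) : cross a b 1 = a 2 * b 0 - a 0 * b 2 := by
  simp [cross, cross_apply]

lemma cross_apply_two (a b : E3) : cross a b 2 = a 0 * b 1 - a 1 * b 0 := by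
  simp [cross, cross_apply]

lemma E3.inner_eq (a b : E3) : inner ℝ a b = a 0 * b 0 + a 1 * b 1 + a 2 * b 2 := by
  simp [PiLp.inner_apply, Fin.sum_univ_three, mul_comm]

lemma E3.ext' {a b : E3} (h0 : a 0 = b 0) (h1 : a 1 = b 1) (h2 : a 2 = b 2) : a = b := by
  ext i; fin_cases i <;> assumption

lemma cross_smul_right (c : ℝ) (a b : E3) : cross a (c • b) = c • cross a b := by
  apply E3.ext' <;> simp only [cross_apply_zero, cross_apply_one, cross_apply_two,
    PiLp.smul_apply, smul_eq_mul] <;> ring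

lemma cross_smul_left (c : ℝ) (a b : E3) : cross (c • a) b = c • cross a b := by
  apply E3.ext' <;> simp only [cross_apply_zero, cross_apply_one, cross_apply_two,
    PiLp.smul_apply, smul_eq_mul] <;> ring

lemma cross_add_right (a b c : E3) : cross a (b + c) = cross a b + cross a c := by
  apply E3.ext' <;> simp only [cross_apply_zero, cross_apply_one, cross_apply_two,
    PiLp.add_apply] <;> ring

/-- Triple vector product expansion. -/
lemma cross_cross_eq (a b c : E3) :
    cross a (cross b c) = (inner ℝ a c : ℝ) • b - (inner ℝ a b : ℝ) • c := by
  apply E3.ext' <;> simp only [cross_apply_zero, cross_apply_one, cross_apply_two, E3.inner_eq,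
    PiLp.smul_apply, PiLp.sub_apply, smul_eq_mul] <;> ring

lemma cross_cross_eq' (a b c : E3) :
    cross (cross a b) c = (inner ℝ a c : ℝ) • b - (inner ℝ b c : ℝ) • a := by
  apply E3.ext' <;> simp only [cross_apply_zero, cross_apply_one, cross_apply_two, E3.inner_eq,
    PiLp.smul_apply, PiLp.sub_apply, smul_eq_mul] <;> ring

lemma cross_comb (a b : E3) (p q r s : ℝ) :
    cross (p • a + q • b) (r • a + s • b) = (p * s - q * r) • cross a b := by
  apply E3.ext' <;> simp only [cross_apply_zero, cross_apply_one, cross_apply_two,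
    PiLp.smul_apply, PiLp.add_apply, smul_eq_mul] <;> ring

lemma norm_cross_sq (a b : E3) : ‖cross a b‖ ^ 2 =
    (inner ℝ a a : ℝ) * inner ℝ b b - inner ℝ a b * inner ℝ b a := by
  rw [← real_inner_self_eq_norm_sq]
  simp only [E3.inner_eq, cross_apply_zero, cross_apply_one, cross_apply_two]
  ring

lemma cross_ne_zero_of_linearIndependent {a : Fin 2 → E3} (h : LinearIndependent ℝ a) :
    cross (a 0) (a 1) ≠ 0 := by
  intro h0
  have h1 : crossProduct (a 0).ofLp (a 1).ofLp ≠ 0 := by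
    rw [crossProduct_ne_zero_iff_linearIndependent]
    have h2 := h.map' (WithLp.linearEquiv 2 ℝ (Fin 3 → ℝ)).toLinearMap (LinearEquiv.ker _)
    have e : (WithLp.linearEquiv 2 ℝ (Fin 3 → ℝ)).toLinearMap ∘ a =
        ![(a 0).ofLp, (a 1).ofLp] := by
      ext i; fin_cases i <;> rfl
    rw [e] at h2
    exact h2
  exact h1 (congrArg WithLp.ofLp h0)

lemma continuous_cross : Continuous fun q : E3 × E3 => cross q.1 q.2 := by
  have h : ∀ q : E3 × E3, cross q.1 q.2 = WithLp.toLp 2 (crossProduct q.1.ofLp q.2.ofLp) :=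
    fun _ => rfl
  simp only [h, cross_apply]
  fun_prop

/-- The cross product of two vectors orthogonal to a unit vector `n` is a multiple of `n`. -/
lemma cross_eq_smul_normal {n a b : E3} (hn : ‖n‖ = 1) (ha : inner ℝ n a = 0)
    (hb : inner ℝ n b = 0) : cross a b = (inner ℝ n (cross a b) : ℝ) • n := by
  -- Expanding n × (n × (a × b)) = 0 leaves a × b equal to its projection on n.
  have h1 : cross n (cross a b) = 0 := by rw [cross_cross_eq, ha, hb]; simp
  have h2 := cross_cross_eq n n (cross a b)
  rw [h1, real_inner_self_eq_norm_sq, hn] at h2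
  have h3 : cross n 0 = 0 := by
    simpa using cross_smul_right 0 n 0
  rw [h3] at h2
  simpa using (sub_eq_zero.1 h2.symm).symm

lemma abs_inner_normal_cross {n a b : E3} (hn : ‖n‖ = 1) (ha : inner ℝ n a = 0)
    (hb : inner ℝ n b = 0) : |(inner ℝ n (cross a b) : ℝ)| = ‖cross a b‖ := by
  conv_rhs => rw [cross_eq_smul_normal hn ha hb, norm_smul, hn, mul_one, Real.norm_eq_abs]

lemma normal_eq_smul_cross {n a b : E3} (hn : ‖n‖ = 1) (ha : inner ℝ n a = 0)
    (hb : inner ℝ n b = 0) (hc : cross a b ≠ 0) :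
    n = ((inner ℝ n (cross a b) : ℝ) / ‖cross a b‖ ^ 2) • cross a b := by
  have h := abs_inner_normal_cross hn ha hb
  have h0 : (inner ℝ n (cross a b) : ℝ) ≠ 0 := by
    rw [← abs_pos, h]; exact norm_pos_iff.2 hc
  rw [← h, sq_abs]
  set s := (inner ℝ n (cross a b) : ℝ) with hs
  rw [cross_eq_smul_normal hn ha hb, ← hs, smul_smul, ← mul_div_right_comm, ← sq,
    div_self (pow_ne_zero 2 h0), one_smul]

/-- The vector products of the unit normal with the contravariant basis. -/
lemma cross_normal_dual {n : E3} {a : Fin 2 → E3} (hn : ‖n‖ = 1)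
    (ha : ∀ l, inner ℝ n (a l) = 0) (hc : cross (a 0) (a 1) ≠ 0)
    {G : Matrix (Fin 2) (Fin 2) ℝ} (hG : G = Matrix.of fun l k => inner ℝ (a l) (a k)) :
    cross n (∑ k, G⁻¹ 0 k • a k) =
        ((inner ℝ n (cross (a 0) (a 1)) : ℝ) / ‖cross (a 0) (a 1)‖ ^ 2) • a 1 ∧
      cross n (∑ k, G⁻¹ 1 k • a k) =
        -(((inner ℝ n (cross (a 0) (a 1)) : ℝ) / ‖cross (a 0) (a 1)‖ ^ 2) • a 0) := by
  -- Lagrange's identity: the Gram determinant is |a_0 × a_1|².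
  have hdet : G.det = ‖cross (a 0) (a 1)‖ ^ 2 := by
    rw [norm_cross_sq, hG, Matrix.det_fin_two]; rfl
  have hd : ‖cross (a 0) (a 1)‖ ^ 2 ≠ 0 := pow_ne_zero 2 (norm_ne_zero_iff.2 hc)
  set c := cross (a 0) (a 1) with hcdef
  set s := (inner ℝ n c : ℝ) with hs
  have hnc : n = (s / ‖c‖ ^ 2) • c := normal_eq_smul_cross hn (ha 0) (ha 1) hc
  have h00 : G⁻¹ 0 0 = (‖c‖ ^ 2)⁻¹ * G 1 1 := by
    simp [Matrix.inv_def, hdet, Matrix.adjugate_fin_two]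
  have h01 : G⁻¹ 0 1 = -((‖c‖ ^ 2)⁻¹ * G 0 1) := by
    simp [Matrix.inv_def, hdet, Matrix.adjugate_fin_two]
  have h10 : G⁻¹ 1 0 = -((‖c‖ ^ 2)⁻¹ * G 1 0) := by
    simp [Matrix.inv_def, hdet, Matrix.adjugate_fin_two]
  have h11 : G⁻¹ 1 1 = (‖c‖ ^ 2)⁻¹ * G 0 0 := by
    simp [Matrix.inv_def, hdet, Matrix.adjugate_fin_two]
  have hcc : ∀ l, cross c (a l) =
      (inner ℝ (a 0) (a l) : ℝ) • a 1 - (inner ℝ (a 1) (a l) : ℝ) • a 0 :=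
    fun l => cross_cross_eq' _ _ _
  have hGe : ∀ l k, G l k = inner ℝ (a l) (a k) := fun l k => by rw [hG]; rfl
  have hcn := norm_cross_sq (a 0) (a 1)
  rw [← hcdef] at hcn
  rw [Fin.sum_univ_two, Fin.sum_univ_two, h00, h01, h10, h11]
  have key : ∀ l, cross n (a l) = (s / ‖c‖ ^ 2) • cross c (a l) := fun l => by
    conv_lhs => rw [hnc]
    rw [cross_smul_left]
  simp only [cross_add_right, cross_smul_right, key, hcc, hGe]
  -- The factor det G / |c|² = 1 is inserted on the right-hand sides; what remains is an identity of
  -- linear combinations of a_0 and a_1.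
  have e : (‖c‖ ^ 2)⁻¹ * (inner ℝ (a 0) (a 0) * inner ℝ (a 1) (a 1)
      - inner ℝ (a 0) (a 1) * inner ℝ (a 1) (a 0) : ℝ) = 1 := by
    rw [← hcn, inv_mul_cancel₀ hd]
  constructor
  · trans (((‖c‖ ^ 2)⁻¹ * (inner ℝ (a 0) (a 0) * inner ℝ (a 1) (a 1)
      - inner ℝ (a 0) (a 1) * inner ℝ (a 1) (a 0) : ℝ)) * (s / ‖c‖ ^ 2)) • a 1
    · rw [real_inner_comm (a 0) (a 1)]
      module
    · rw [e, one_mul]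
  · trans -((((‖c‖ ^ 2)⁻¹ * (inner ℝ (a 0) (a 0) * inner ℝ (a 1) (a 1)
      - inner ℝ (a 0) (a 1) * inner ℝ (a 1) (a 0) : ℝ)) * (s / ‖c‖ ^ 2)) • a 0)
    · rw [real_inner_comm (a 0) (a 1)]
      module
    · rw [e, one_mul]

/-- A unit vector `t` along `b` for which `n × t` is on the side of `a`. -/
lemma unit_tangent_eq {n t a b : E3} (hn : ‖n‖ = 1) (ha : inner ℝ n a = 0)
    (hb : inner ℝ n b = 0) (hc : cross a b ≠ 0) (ht : ‖t‖ = 1) {c : ℝ} (htc : t = c • b)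
    {p q : ℝ} (hp : 0 < p) (hin : cross n t = p • a + q • b) :
    ‖b‖ • t = -(((inner ℝ n (cross a b) : ℝ) / ‖cross a b‖) • b) := by
  set s := (inner ℝ n (cross a b) : ℝ) with hs
  -- Multiplying by b removes the unknown q. The triple product then gives −c |b|² = p s, so c and s
  -- have opposite signs, and |c| |b| = 1 fixes c.
  have h1 : cross (cross n t) b = p • cross a b := by
    have := cross_comb a b p q 0 1
    rw [hin]; simpa using this
  rw [cross_cross_eq', hb, htc, real_inner_smul_left, real_inner_self_eq_norm_sq] at h1
  have h2 : -(c * ‖b‖ ^ 2) = p * s := by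
    have := congrArg (fun v => (inner ℝ n v : ℝ)) h1
    simpa [inner_smul_right, inner_sub_right, hn] using this
  have h3 : |c| * ‖b‖ = 1 := by rw [← ht, htc, norm_smul, Real.norm_eq_abs]
  have hb0 : 0 < ‖b‖ := by
    rcases (norm_nonneg b).eq_or_lt with h | h
    · rw [← h] at h3; simp at h3
    · exact h
  have hs0 : s ≠ 0 := fun h => hc (by rw [cross_eq_smul_normal hn ha hb, ← hs, h, zero_smul])
  have h4 : ‖b‖ * c = -(s / |s|) := by
    rcases hs0.lt_or_gt with h | h
    · have hc0 : 0 < c := by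
        by_contra hcn
        have := mul_nonneg (neg_nonneg.2 (not_lt.1 hcn)) (sq_nonneg ‖b‖)
        have := mul_neg_of_pos_of_neg hp h
        linarith
      rw [abs_of_pos hc0] at h3
      rw [abs_of_neg h, div_neg, div_self hs0]
      linarith
    · have hc0 : c < 0 := by
        by_contra hcn
        have := mul_nonneg (not_lt.1 hcn) (sq_nonneg ‖b‖)
        have := mul_pos hp h
        linarith
      rw [abs_of_neg hc0] at h3
      rw [abs_of_pos h, div_self hs0]
      linarith
  rw [hs, abs_inner_normal_cross hn ha hb, ← hs] at h4
  rw [htc, smul_smul, h4, neg_smul]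

end VectorAlgebra

/-! ### Gluing of measures. -/

section Gluing

/-- Measures `m i` carried by open sets `U i` that agree on the overlaps glue to their supremum. -/
lemma MeasureTheory.Measure.iSup_restrict_eq {X ι : Type*} [MeasurableSpace X] {m : ι → Measure X}
    {U : ι → Set X} (hU : ∀ i, MeasurableSet (U i)) (hm : ∀ i, m i (U i)ᶜ = 0)
    (h : ∀ i j, ∀ A, MeasurableSet A → A ⊆ U i ∩ U j → m i A ≤ m j A) (i : ι) :
    (⨆ j, m j).restrict (U i) = m i := by
  have hle : ∀ j, m j ≤ ⨆ j, m j := le_iSup m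
  have hres : (m i).restrict (U i) = m i := by
    rw [Measure.restrict_eq_self_of_ae_mem]
    exact hm i
  -- It suffices to exhibit one upper bound of the family whose restriction to `U i` is `m i`.
  -- Inside `U i` each `m k` lives on the overlap and is dominated by `m i`; outside, by the
  -- supremum itself.
  have hub : (⨆ j, m j) ≤ m i + (⨆ j, m j).restrict (U i)ᶜ := by
    refine iSup_le fun k => Measure.le_iff.2 fun A hA => ?_
    have h0 : m k A ≤ m k (A ∩ U k ∩ U i) + m k (A ∩ (U i)ᶜ) := by
      have h1 : m k A ≤ m k (A ∩ U k ∩ U i ∪ A ∩ (U i)ᶜ ∪ (U k)ᶜ) := by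
        refine measure_mono fun z hz => ?_
        by_cases h1 : z ∈ U k <;> by_cases h2 : z ∈ U i <;> simp [hz, h1, h2]
      refine h1.trans ((measure_union_le _ _).trans ?_)
      rw [hm k, add_zero]
      exact measure_union_le _ _
    rw [Measure.add_apply, Measure.restrict_apply hA]
    refine h0.trans (add_le_add ?_ (Measure.le_iff'.1 (hle k) _))
    refine (h k i _ ((hA.inter (hU k)).inter (hU i)) ?_).trans (measure_mono ?_)
    · exact fun z hz => ⟨hz.1.2, hz.2⟩
    · exact fun z hz => hz.1.1
  refine le_antisymm ?_ ?_
  · have := Measure.restrict_mono (le_refl (U i)) hub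
    rwa [Measure.restrict_add, hres, Measure.restrict_restrict (hU i), inter_compl_self,
      Measure.restrict_empty, add_zero] at this
  · have := Measure.restrict_mono (le_refl (U i)) (hle i)
    rwa [hres] at this

end Gluing

/-! ### Measures given by a parametrization and a density. -/

section ParamMeasure

variable {E : Type*} [NormedAddCommGroup E] [MeasureSpace E] [BorelSpace E]
  {M : Type*} [TopologicalSpace M] [MeasurableSpace M] [BorelSpace M]
  {ψ : E → M} {T : Set E} {d : E → ℝ}

/-- The image under `ψ` of the measure with density `d` on `T`. -/
def paramMeasure (ψ : E → M) (T : Set E) (d : E → ℝ) : Measure M :=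
  Measure.map ψ ((volume.restrict T).withDensity fun u => ENNReal.ofReal (d u))

lemma paramMeasure_aemeasurable (hT : MeasurableSet T) (hψ : ContinuousOn ψ T) :
    AEMeasurable ψ ((volume.restrict T).withDensity fun u => ENNReal.ofReal (d u)) :=
  (hψ.aemeasurable hT).mono_ac (withDensity_absolutelyContinuous _ _)

lemma density_aemeasurable (hT : MeasurableSet T) (hd : ContinuousOn d T) :
    AEMeasurable (fun u => ENNReal.ofReal (d u)) (volume.restrict T) :=
  (hd.aemeasurable hT).ennreal_ofReal

/-- Inverse charts are controlled on `T` only, so preimages are cut down to `T`; the rest is null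
for the measure being pushed forward. -/
lemma paramMeasure_apply (hT : MeasurableSet T) (hψ : ContinuousOn ψ T)
    {A : Set M} (hA : MeasurableSet A) (hTA : MeasurableSet (T ∩ ψ ⁻¹' A)) :
    paramMeasure ψ T d A = ∫⁻ u in T ∩ ψ ⁻¹' A, ENNReal.ofReal (d u) := by
  rw [paramMeasure, Measure.map_apply_of_aemeasurable (paramMeasure_aemeasurable hT hψ) hA]
  have h1 : ((volume.restrict T).withDensity fun u => ENNReal.ofReal (d u)) (ψ ⁻¹' A) =
      ((volume.restrict T).withDensity fun u => ENNReal.ofReal (d u)) (T ∩ ψ ⁻¹' A) := by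
    refine measure_congr ?_
    have : ∀ᵐ u ∂((volume.restrict T).withDensity fun u => ENNReal.ofReal (d u)), u ∈ T :=
      (withDensity_absolutelyContinuous _ _).ae_le (ae_restrict_mem hT)
    filter_upwards [this] with u hu
    exact propext ⟨fun h => ⟨hu, h⟩, fun h => h.2⟩
  rw [h1, withDensity_apply _ hTA, Measure.restrict_restrict hTA,
    inter_assoc, inter_comm _ T, ← inter_assoc, inter_self]

lemma measurableSet_inter_preimage_of_continuousOn {X Y : Type*} [TopologicalSpace X]
    [MeasurableSpace X] [OpensMeasurableSpace X] [TopologicalSpace Y] [MeasurableSpace Y]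
    [BorelSpace Y] {ψ : X → Y} {T : Set X} (hT : MeasurableSet T) (hψ : ContinuousOn ψ T)
    {A : Set Y} (hA : MeasurableSet A) : MeasurableSet (T ∩ ψ ⁻¹' A) := by
  have h : Measurable (T.domRestrict ψ) := (continuousOn_iff_continuous_domRestrict.1 hψ).measurable
  have h2 := hT.subtype_image (h hA)
  convert h2 using 1
  ext u
  simp only [mem_inter_iff, mem_preimage, mem_image, Subtype.exists, exists_and_right,
    exists_eq_right, Set.domRestrict_apply, exists_prop]

lemma paramMeasure_compl_eq_zero (hT : MeasurableSet T) (hψ : ContinuousOn ψ T)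
    {A : Set M} (hA : MeasurableSet A) (h : ∀ u ∈ T, ψ u ∈ A) :
    paramMeasure ψ T d Aᶜ = 0 := by
  have : T ∩ ψ ⁻¹' Aᶜ = ∅ := by
    ext u
    simpa using h u
  rw [paramMeasure_apply hT hψ hA.compl (by rw [this]; exact MeasurableSet.empty), this]
  simp

lemma integral_paramMeasure {W : Type*} [NormedAddCommGroup W] [NormedSpace ℝ W]
    (hT : MeasurableSet T) (hψ : ContinuousOn ψ T) (hd : ContinuousOn d T)
    (hd0 : ∀ u, 0 ≤ d u) {F : M → W} (hF : AEStronglyMeasurable F (paramMeasure ψ T d)) :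
    ∫ z, F z ∂(paramMeasure ψ T d) = ∫ u in T, d u • F (ψ u) := by
  rw [paramMeasure, integral_map (paramMeasure_aemeasurable hT hψ) hF]
  rw [integral_withDensity_eq_integral_toReal_smul₀ (density_aemeasurable hT hd)
    (Filter.Eventually.of_forall fun _ => ENNReal.ofReal_lt_top)]
  simp [ENNReal.toReal_ofReal (hd0 _)]

/-- Two parametrizations give the same measure on overlaps. -/
lemma paramMeasure_le_of_change [NormedSpace ℝ E] [FiniteDimensional ℝ E]
    [(volume : Measure E).IsAddHaarMeasure] (hT : MeasurableSet T) (hψ : ContinuousOn ψ T)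
    {ψ' : E → M} {T' : Set E} {d' : E → ℝ} (hT' : MeasurableSet T') (hψ' : ContinuousOn ψ' T')
    {A : Set M} (hA : MeasurableSet A) {φ : E → E} {J : E → E →L[ℝ] E}
    (hmaps : ∀ u ∈ T, ψ u ∈ A → φ u ∈ T' ∧ ψ' (φ u) = ψ u)
    (hinj : InjOn φ (T ∩ ψ ⁻¹' A))
    (hJ : ∀ u ∈ T, ψ u ∈ A → HasFDerivWithinAt φ (J u) T u)
    (hd : ∀ u ∈ T, ψ u ∈ A → d u = |(J u).det| * d' (φ u)) :
    paramMeasure ψ T d A ≤ paramMeasure ψ' T' d' A := by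
  have hS := measurableSet_inter_preimage_of_continuousOn hT hψ hA
  rw [paramMeasure_apply hT hψ hA hS, paramMeasure_apply hT' hψ' hA
    (measurableSet_inter_preimage_of_continuousOn hT' hψ' hA)]
  calc ∫⁻ u in T ∩ ψ ⁻¹' A, ENNReal.ofReal (d u)
      = ∫⁻ u in T ∩ ψ ⁻¹' A, ENNReal.ofReal |(J u).det| * ENNReal.ofReal (d' (φ u)) := by
        refine setLIntegral_congr_fun hS fun u hu => ?_
        rw [hd u hu.1 hu.2, ENNReal.ofReal_mul (abs_nonneg _)]
    _ = ∫⁻ v in φ '' (T ∩ ψ ⁻¹' A), ENNReal.ofReal (d' v) :=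
        (lintegral_image_eq_lintegral_abs_det_fderiv_mul volume hS
          (fun u hu => (hJ u hu.1 hu.2).mono inter_subset_left) hinj
          fun v => ENNReal.ofReal (d' v)).symm
    -- The inclusion of the image suffices: gluing asks for this inequality for every ordered pair
    -- of charts.
    _ ≤ ∫⁻ v in T' ∩ ψ' ⁻¹' A, ENNReal.ofReal (d' v) := by
        refine lintegral_mono_set ?_
        rintro _ ⟨u, hu, rfl⟩
        obtain ⟨h1, h2⟩ := hmaps u hu.1 hu.2
        exact ⟨h1, by rw [mem_preimage, h2]; exact hu.2⟩

/-- Near `u₀` the density stays below `d u₀ + 1`, and a ball has finite volume. This yields local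
finiteness of the area and the length. -/
lemma exists_paramMeasure_lt_top [ProperSpace E]
    [IsFiniteMeasureOnCompacts (volume : Measure E)] (hT : MeasurableSet T) (hψ : ContinuousOn ψ T)
    (hd : ContinuousOn d T) {u₀ : E} (hu₀ : u₀ ∈ T) :
    ∃ r > 0, ∀ A : Set M, MeasurableSet A → (∀ u ∈ T, ψ u ∈ A → u ∈ Metric.ball u₀ r) →
      paramMeasure ψ T d A < ⊤ := by
  have h1 : ∀ᶠ u in nhdsWithin u₀ T, d u < d u₀ + 1 :=
    (hd u₀ hu₀).eventually (gt_mem_nhds (lt_add_one _))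
  obtain ⟨r, hr, hball⟩ := Metric.mem_nhdsWithin_iff.1 h1
  refine ⟨r, hr, fun A hA hAr => ?_⟩
  have hS := measurableSet_inter_preimage_of_continuousOn hT hψ hA
  rw [paramMeasure_apply hT hψ hA hS]
  calc ∫⁻ u in T ∩ ψ ⁻¹' A, ENNReal.ofReal (d u)
      ≤ ∫⁻ u in T ∩ ψ ⁻¹' A, ENNReal.ofReal (d u₀ + 1) := by
        refine setLIntegral_mono' hS fun u hu => ENNReal.ofReal_le_ofReal ?_
        exact (hball ⟨hAr u hu.1 hu.2, hu.1⟩ : d u < d u₀ + 1).le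
    _ ≤ ENNReal.ofReal (d u₀ + 1) * volume (Metric.ball u₀ r) := by
        rw [setLIntegral_const]
        gcongr
        exact fun u hu => hAr u hu.1 hu.2
    _ < ⊤ := ENNReal.mul_lt_top ENNReal.ofReal_lt_top measure_ball_lt_top

end ParamMeasure

/-! ### Green's formula in the half-plane. -/

section HalfPlane

/-- Points of the parameter plane from pairs of coordinates. -/
def planeEquiv : (ℝ × ℝ) ≃L[ℝ] E2 :=
  (ContinuousLinearEquiv.finTwoArrow ℝ ℝ).symm.trans (EuclideanSpace.equiv (Fin 2) ℝ).symm

lemma planeEquiv_apply (q : ℝ × ℝ) : planeEquiv q = !₂[q.1, q.2] := rfl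

lemma measurePreserving_planeEquiv : MeasurePreserving planeEquiv := by
  have h1 := (volume_preserving_finTwoArrow ℝ).symm
  have h2 := (EuclideanSpace.volume_preserving_symm_measurableEquiv_toLp (Fin 2)).symm
  exact h2.comp h1

lemma measurableEmbedding_planeEquiv : MeasurableEmbedding planeEquiv :=
  planeEquiv.toHomeomorph.measurableEmbedding

/-- The closed half-plane. -/
abbrev halfPlane : Set E2 := range (𝓡∂ 2)

lemma mem_halfPlane {u : E2} : u ∈ halfPlane ↔ 0 ≤ u 0 := by
  rw [halfPlane, range_modelWithCornersEuclideanHalfSpace]; rfl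

lemma isClosed_halfPlane : IsClosed halfPlane := (𝓡∂ 2).isClosed_range

lemma uniqueDiffOn_halfPlane : UniqueDiffOn ℝ halfPlane := (𝓡∂ 2).uniqueDiffOn

lemma halfPlane_mem_nhds {u : E2} (hu : 0 < u 0) : halfPlane ∈ nhds u := by
  have h : IsOpen {v : E2 | 0 < v 0} := isOpen_lt continuous_const (by fun_prop)
  filter_upwards [h.mem_nhds hu] with v hv
  exact mem_halfPlane.2 (le_of_lt hv)

variable {W : Type*} [NormedAddCommGroup W] [NormedSpace ℝ W]

/-- Green's formula in the half-plane, for fields with bounded support. -/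
lemma integral_halfPlane_curl {h₀ h₁ : E2 → W} (hh₀ : ContDiffOn ℝ 1 h₀ halfPlane)
    (hh₁ : ContDiffOn ℝ 1 h₁ halfPlane) {R : ℝ} (hR : 0 < R)
    (hs₀ : ∀ u ∈ halfPlane, R ≤ ‖u‖ → h₀ u = 0) (hs₁ : ∀ u ∈ halfPlane, R ≤ ‖u‖ → h₁ u = 0) :
    ∫ u in halfPlane, (fderivWithin ℝ h₁ halfPlane u (EuclideanSpace.single 0 1) -
      fderivWithin ℝ h₀ halfPlane u (EuclideanSpace.single 1 1)) =
    -∫ t : ℝ, h₁ !₂[0, t] := by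
  set D : E2 → W := fun u => fderivWithin ℝ h₁ halfPlane u (EuclideanSpace.single 0 1) -
      fderivWithin ℝ h₀ halfPlane u (EuclideanSpace.single 1 1) with hD
  have hDc : ContinuousOn D halfPlane := by
    have c1 := hh₁.continuousOn_fderivWithin uniqueDiffOn_halfPlane le_rfl
    have c0 := hh₀.continuousOn_fderivWithin uniqueDiffOn_halfPlane le_rfl
    exact (c1.clm_apply continuousOn_const).sub (c0.clm_apply continuousOn_const)
  have hDs : ∀ u ∈ halfPlane, R < ‖u‖ → D u = 0 := by
    intro u hu hRu
    have hev : ∀ h : E2 → W, (∀ u ∈ halfPlane, R ≤ ‖u‖ → h u = 0) →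
        fderivWithin ℝ h halfPlane u = 0 := by
      intro h hs
      have : h =ᶠ[nhdsWithin u halfPlane] fun _ => 0 := by
        have : ∀ᶠ v in nhdsWithin u halfPlane, R < ‖v‖ :=
          (continuous_norm.continuousWithinAt (s := halfPlane)).eventually (lt_mem_nhds hRu)
        filter_upwards [this, self_mem_nhdsWithin] with v hv hvH
        exact hs v hvH hv.le
      rw [this.fderivWithin_eq_of_mem hu]
      simp
    simp [hD, hev _ hs₀, hev _ hs₁]
  have hnorm : ∀ q : ℝ × ℝ, |q.1| ≤ ‖planeEquiv q‖ ∧ |q.2| ≤ ‖planeEquiv q‖ := fun q =>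
    ⟨PiLp.norm_apply_le (planeEquiv q) 0, PiLp.norm_apply_le (planeEquiv q) 1⟩
  -- One side of this box lies on the edge x⁰ = 0; the other three lie beyond radius R, where the
  -- fields vanish.
  set a : ℝ × ℝ := (0, -(R + 1)) with ha
  set b : ℝ × ℝ := (R + 1, R + 1) with hb
  have hab : a ≤ b := ⟨by simp [ha, hb]; linarith, by simp [ha, hb]; linarith⟩
  have hIcc : ∀ q ∈ Icc a b, planeEquiv q ∈ halfPlane := fun q hq =>
    mem_halfPlane.2 hq.1.1
  have hIoo : ∀ q ∈ Ioo a.1 b.1 ×ˢ Ioo a.2 b.2, 0 < planeEquiv q 0 := fun q hq => hq.1.1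
  have hcont : ∀ {h : E2 → W}, ContinuousOn h halfPlane →
      ContinuousOn (fun q => h (planeEquiv q)) (Icc a b) := fun hh =>
    hh.comp planeEquiv.continuous.continuousOn hIcc
  -- The divergence theorem needs derivatives only in the open box, where the half-plane is a
  -- neighbourhood and one-sided derivatives are genuine.
  have hder : ∀ {h : E2 → W}, ContDiffOn ℝ 1 h halfPlane → ∀ q ∈ Ioo a.1 b.1 ×ˢ Ioo a.2 b.2,
      HasFDerivAt (fun q => h (planeEquiv q))
        ((fderivWithin ℝ h halfPlane (planeEquiv q)).comp
          (planeEquiv : (ℝ × ℝ) →L[ℝ] E2)) q := by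
    intro h hh q hq
    have h1 := (hh.differentiableOn one_ne_zero _
      (mem_halfPlane.2 (hIoo q hq).le)).hasFDerivWithinAt.hasFDerivAt
        (halfPlane_mem_nhds (hIoo q hq))
    exact h1.comp q planeEquiv.hasFDerivAt
  have e0 : planeEquiv ((1, 0) : ℝ × ℝ) = EuclideanSpace.single 0 1 := by
    ext i; fin_cases i <;> simp [planeEquiv_apply]
  have e1 : planeEquiv ((0, 1) : ℝ × ℝ) = EuclideanSpace.single 1 1 := by
    ext i; fin_cases i <;> simp [planeEquiv_apply]
  -- The curl of (h₀, h₁) is the divergence of (h₁, −h₀).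
  have hint := integral_divergence_prod_Icc_of_hasFDerivAt_of_le
    (fun q => h₁ (planeEquiv q)) (fun q => -h₀ (planeEquiv q)) _ _ a b hab
    (hcont hh₁.continuousOn) (hcont hh₀.continuousOn).neg (hder hh₁)
    (fun q hq => (hder hh₀ q hq).neg)
    (by
      refine ContinuousOn.integrableOn_compact isCompact_Icc ?_
      refine (hcont hDc).congr fun q _ => ?_
      simp [hD, e0, e1, sub_eq_add_neg])
  have hL : ∫ u in halfPlane, D u = ∫ q in Icc a b, D (planeEquiv q) := by
    rw [← measurePreserving_planeEquiv.setIntegral_preimage_emb measurableEmbedding_planeEquiv]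
    refine setIntegral_eq_of_subset_of_forall_sdiff_eq_zero ?_ hIcc ?_
    · exact measurableEmbedding_planeEquiv.measurable isClosed_halfPlane.measurableSet
    · rintro q ⟨hq, hqn⟩
      refine hDs _ hq ?_
      by_contra hlt
      have hlt := not_lt.1 hlt
      obtain ⟨n1, n2⟩ := hnorm q
      have n1 := abs_le.1 (n1.trans hlt)
      have n2 := abs_le.1 (n2.trans hlt)
      have h0 : 0 ≤ q.1 := mem_halfPlane.1 hq
      exact hqn ⟨⟨h0, by simp [ha]; linarith [n2.1]⟩,
        ⟨by simp [hb]; linarith [n1.2], by simp [hb]; linarith [n2.2]⟩⟩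
  have z0 : ∀ x ∈ uIcc a.1 b.1, ∀ y : ℝ, R ≤ |y| → h₀ (planeEquiv (x, y)) = 0 := by
    intro x hx y hy
    rw [uIcc_of_le hab.1] at hx
    exact hs₀ _ (mem_halfPlane.2 hx.1) (hy.trans (hnorm (x, y)).2)
  have z1 : ∀ y : ℝ, h₁ (planeEquiv (b.1, y)) = 0 := by
    intro y
    refine hs₁ _ (mem_halfPlane.2 ?_) (le_trans ?_ (hnorm (b.1, y)).1)
    · change 0 ≤ R + 1; linarith
    · change R ≤ |R + 1|; exact le_trans (by linarith) (le_abs_self _)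
  have i1 : ∫ x in a.1..b.1, -h₀ (planeEquiv (x, b.2)) = 0 := by
    refine intervalIntegral.integral_zero_ae (Filter.Eventually.of_forall fun x hx => ?_)
    rw [z0 x (uIoc_subset_uIcc hx) _ (by
      change R ≤ |R + 1|; exact le_trans (by linarith) (le_abs_self _)), neg_zero]
  have i2 : ∫ x in a.1..b.1, -h₀ (planeEquiv (x, a.2)) = 0 := by
    refine intervalIntegral.integral_zero_ae (Filter.Eventually.of_forall fun x hx => ?_)
    rw [z0 x (uIoc_subset_uIcc hx) _ (by
      change R ≤ |-(R + 1)|; rw [abs_neg]; exact le_trans (by linarith) (le_abs_self _)), neg_zero]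
  have i3 : ∫ y in a.2..b.2, h₁ (planeEquiv (a.1, y)) = ∫ t : ℝ, h₁ !₂[0, t] := by
    refine intervalIntegral.integral_eq_integral_of_support_subset fun t ht => ?_
    have hlt : ‖planeEquiv (0, t)‖ < R := by
      by_contra hn
      exact ht (hs₁ _ (mem_halfPlane.2 le_rfl) (not_lt.1 hn))
    have := abs_lt.1 ((hnorm (0, t)).2.trans_lt hlt)
    exact ⟨by simp [ha]; linarith [this.1], by simp [hb]; linarith [this.2]⟩
  rw [hL]
  rw [i1, i2, i3] at hint
  simp only [z1, intervalIntegral.integral_zero, sub_zero, zero_add, zero_sub] at hint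
  rw [← hint]
  refine integral_congr_ae (Filter.Eventually.of_forall fun q => ?_)
  simp [hD, e0, e1, sub_eq_add_neg]

end HalfPlane

/-! ### Continuity of the vector product and of bilinear operations. -/

lemma ContinuousOn.cross {X : Type*} [TopologicalSpace X] {a b : X → E3} {s : Set X}
    (ha : ContinuousOn a s) (hb : ContinuousOn b s) :
    ContinuousOn (fun z => cross (a z) (b z)) s :=
  continuous_cross.comp_continuousOn (ha.prodMk hb)

/-- A bilinear map on finite-dimensional spaces, as a continuous bilinear map. -/
def LinearMap.toContinuousBilin {U V W : Type*} [NormedAddCommGroup U] [NormedSpace ℝ U]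
    [FiniteDimensional ℝ U] [NormedAddCommGroup V] [NormedSpace ℝ V] [FiniteDimensional ℝ V]
    [NormedAddCommGroup W] [NormedSpace ℝ W] (op : U →ₗ[ℝ] V →ₗ[ℝ] W) : U →L[ℝ] V →L[ℝ] W :=
  LinearMap.toContinuousLinearMap (LinearMap.toContinuousLinearMap.toLinearMap ∘ₗ op)

lemma LinearMap.toContinuousBilin_apply {U V W : Type*} [NormedAddCommGroup U] [NormedSpace ℝ U]
    [FiniteDimensional ℝ U] [NormedAddCommGroup V] [NormedSpace ℝ V] [FiniteDimensional ℝ V]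
    [NormedAddCommGroup W] [NormedSpace ℝ W] (op : U →ₗ[ℝ] V →ₗ[ℝ] W) (a : U) (v : V) :
    op.toContinuousBilin a v = op a v := rfl

lemma LinearMap.continuous_uncurried {U V W : Type*} [NormedAddCommGroup U] [NormedSpace ℝ U]
    [FiniteDimensional ℝ U] [NormedAddCommGroup V] [NormedSpace ℝ V] [FiniteDimensional ℝ V]
    [NormedAddCommGroup W] [NormedSpace ℝ W] (op : U →ₗ[ℝ] V →ₗ[ℝ] W) :
    Continuous fun q : U × V => op q.1 q.2 :=
  op.toContinuousBilin.continuous₂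

/-! ### Change of surface coordinates. -/

namespace Surface

lemma det_eq_entries (J : E2 →L[ℝ] E2) : J.det =
    J (EuclideanSpace.single 0 1) 0 * J (EuclideanSpace.single 1 1) 1 -
      J (EuclideanSpace.single 0 1) 1 * J (EuclideanSpace.single 1 1) 0 := by
  rw [ContinuousLinearMap.det, ← LinearMap.det_toMatrix (EuclideanSpace.basisFun (Fin 2) ℝ).toBasis,
    Matrix.det_fin_two]
  simp [LinearMap.toMatrix_apply]
  ring

section

variable {M : Type*} [TopologicalSpace M] [ChartedSpace (EuclideanHalfSpace 2) M]
  {V : Type*} [NormedAddCommGroup V] [NormedSpace ℝ V]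
  {W : Type*} [NormedAddCommGroup W] [NormedSpace ℝ W]

/-- The derivative of the change of coordinates from the chart around `x` to the one around `y`. -/
def chartJac (x y : M) (u : E2) : E2 →L[ℝ] E2 :=
  fderivWithin ℝ (extChartAt (𝓡∂ 2) y ∘ (extChartAt (𝓡∂ 2) x).symm) halfPlane u

/-- The coordinate tangent vectors of the chart around `x`, as vectors at points of the surface. -/
def tangentVec (f : M → V) (x z : M) (l : Fin 2) : V :=
  partialDeriv x f (extChartAt (𝓡∂ 2) x z) l

/-- Data at `z` use the chart around `z`, which need not vary continuously with `z`. `tangentVec`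
frees the chart, so that these data can be compared with those of one fixed chart. -/
lemma covBasis_eq_tangentVec (f : M → E3) (z : M) : covBasis f z = tangentVec f z z := rfl

lemma extChartAt_mem_halfPlane (x z : M) : extChartAt (𝓡∂ 2) x z ∈ halfPlane := ⟨_, rfl⟩

lemma IsRegularSurface.contMDiff_one {f : M → E3} (hf : IsRegularSurface f) :
    ContMDiff (𝓡∂ 2) 𝓘(ℝ, E3) 1 f := hf.smooth.of_le (by exact_mod_cast le_top)

variable [IsManifold (𝓡∂ 2) ∞ M]

lemma hasFDerivWithinAt_chartJac {x y z : M} (hx : z ∈ (extChartAt (𝓡∂ 2) x).source)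
    (hy : z ∈ (extChartAt (𝓡∂ 2) y).source) :
    HasFDerivWithinAt (extChartAt (𝓡∂ 2) y ∘ (extChartAt (𝓡∂ 2) x).symm)
      (chartJac x y (extChartAt (𝓡∂ 2) x z)) halfPlane (extChartAt (𝓡∂ 2) x z) := by
  have h : ContDiffWithinAt ℝ ∞ (extChartAt (𝓡∂ 2) y ∘ (extChartAt (𝓡∂ 2) x).symm)
      halfPlane (extChartAt (𝓡∂ 2) x z) := by
    refine contDiffWithinAt_ext_coord_change y x ?_
    rw [PartialEquiv.trans_source, PartialEquiv.symm_source]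
    exact ⟨(extChartAt (𝓡∂ 2) x).map_source hx, by
      rw [mem_preimage, (extChartAt (𝓡∂ 2) x).left_inv hx]; exact hy⟩
  exact (h.differentiableWithinAt (by simp)).hasFDerivWithinAt

lemma contDiffOn_comp_symm {m : ℕ∞} {Φ : M → V} (hΦ : ContMDiff (𝓡∂ 2) 𝓘(ℝ, V) m Φ) (x : M) :
    ContDiffOn ℝ m (Φ ∘ (extChartAt (𝓡∂ 2) x).symm) (extChartAt (𝓡∂ 2) x).target := by
  have hI : IsManifold (𝓡∂ 2) m M := IsManifold.of_le (n := ∞) (by exact_mod_cast le_top)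
  rw [← contMDiffOn_iff_contDiffOn]
  exact hΦ.comp_contMDiffOn (contMDiffOn_extChartAt_symm x)

lemma contDiffWithinAt_comp_symm {m : ℕ∞} {Φ : M → V} (hΦ : ContMDiff (𝓡∂ 2) 𝓘(ℝ, V) m Φ)
    (x : M) {u : E2} (hu : u ∈ (extChartAt (𝓡∂ 2) x).target) :
    ContDiffWithinAt ℝ m (Φ ∘ (extChartAt (𝓡∂ 2) x).symm) halfPlane u :=
  (contDiffOn_comp_symm hΦ x u hu).mono_of_mem_nhdsWithin
    (extChartAt_target_mem_nhdsWithin_of_mem hu)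

lemma differentiableWithinAt_comp_symm {Φ : M → V} (hΦ : ContMDiff (𝓡∂ 2) 𝓘(ℝ, V) 1 Φ)
    (x : M) {u : E2} (hu : u ∈ (extChartAt (𝓡∂ 2) x).target) :
    DifferentiableWithinAt ℝ (Φ ∘ (extChartAt (𝓡∂ 2) x).symm) halfPlane u :=
  (contDiffWithinAt_comp_symm (m := 1) hΦ x hu).differentiableWithinAt (by simp)

/-- Smoothness on the target controls derivatives within the target; they agree with those within
the half-plane because the target is relatively open in it. -/
lemma continuousOn_partialDeriv {Φ : M → V} (hΦ : ContMDiff (𝓡∂ 2) 𝓘(ℝ, V) 1 Φ) (x : M)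
    (l : Fin 2) : ContinuousOn (fun u => partialDeriv x Φ u l) (extChartAt (𝓡∂ 2) x).target := by
  have h := (contDiffOn_comp_symm (m := 1) hΦ x).continuousOn_fderivWithin
    (uniqueDiffOn_extChartAt_target x) (by simp)
  refine (h.clm_apply (continuousOn_const (c := EuclideanSpace.single l 1))).congr fun u hu => ?_
  rw [partialDeriv, fderivWithin_of_mem_nhdsWithin
    (extChartAt_target_mem_nhdsWithin_of_mem hu)
    (uniqueDiffOn_halfPlane u (extChartAt_target_subset_range x hu))
    ((contDiffOn_comp_symm (m := 1) hΦ x).differentiableOn (by simp) u hu)]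

lemma continuousOn_tangentVec {Φ : M → V} (hΦ : ContMDiff (𝓡∂ 2) 𝓘(ℝ, V) 1 Φ) (x : M)
    (l : Fin 2) : ContinuousOn (fun z => tangentVec Φ x z l) (extChartAt (𝓡∂ 2) x).source :=
  (continuousOn_partialDeriv hΦ x l).comp (continuousOn_extChartAt x)
    fun _ hz => (extChartAt (𝓡∂ 2) x).map_source hz

lemma E2.eq_sum (w : E2) :
    w = w 0 • EuclideanSpace.single 0 1 + w 1 • EuclideanSpace.single 1 1 := by
  ext i; fin_cases i <;> simp

/-- The transformation rule of partial derivatives under a change of charts. -/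
lemma tangentVec_change {Φ : M → V} (hΦ : ContMDiff (𝓡∂ 2) 𝓘(ℝ, V) 1 Φ) {x y z : M}
    (hx : z ∈ (extChartAt (𝓡∂ 2) x).source) (hy : z ∈ (extChartAt (𝓡∂ 2) y).source) (l : Fin 2) :
    tangentVec Φ x z l =
      chartJac x y (extChartAt (𝓡∂ 2) x z) (EuclideanSpace.single l 1) 0 • tangentVec Φ y z 0 +
      chartJac x y (extChartAt (𝓡∂ 2) x z) (EuclideanSpace.single l 1) 1 • tangentVec Φ y z 1 := by
  have hJ := hasFDerivWithinAt_chartJac hx hy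
  have hux := (extChartAt (𝓡∂ 2) x).map_source hx
  have huy := (extChartAt (𝓡∂ 2) y).map_source hy
  have hdy := (differentiableWithinAt_comp_symm hΦ y huy).hasFDerivWithinAt
  have hpt : (extChartAt (𝓡∂ 2) y ∘ (extChartAt (𝓡∂ 2) x).symm) (extChartAt (𝓡∂ 2) x z) =
      extChartAt (𝓡∂ 2) y z := by
    rw [Function.comp_apply, (extChartAt (𝓡∂ 2) x).left_inv hx]
  rw [← hpt] at hdy
  have hcomp := hdy.comp _ hJ (fun u _ => extChartAt_mem_halfPlane y _)
  -- Chart maps are total functions, so the factorization through the chart around `y` is available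
  -- only near `z`.
  have hev : Φ ∘ (extChartAt (𝓡∂ 2) x).symm =ᶠ[nhdsWithin (extChartAt (𝓡∂ 2) x z) halfPlane]
      (Φ ∘ (extChartAt (𝓡∂ 2) y).symm) ∘
        (extChartAt (𝓡∂ 2) y ∘ (extChartAt (𝓡∂ 2) x).symm) := by
    have h1 : ContinuousWithinAt (extChartAt (𝓡∂ 2) x).symm halfPlane
        (extChartAt (𝓡∂ 2) x z) := (continuousAt_extChartAt_symm' hx).continuousWithinAt
    have h2 := h1.preimage_mem_nhdsWithin ((isOpen_extChartAt_source y).mem_nhds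
      (by rw [(extChartAt (𝓡∂ 2) x).left_inv hx]; exact hy))
    filter_upwards [h2] with u hu
    simp only [Function.comp_apply, (extChartAt (𝓡∂ 2) y).left_inv hu]
  have hfin := hcomp.congr_of_eventuallyEq hev (hev.eq_of_nhdsWithin (extChartAt_mem_halfPlane x z))
  rw [hpt] at hfin
  rw [tangentVec, partialDeriv,
    hfin.fderivWithin (uniqueDiffOn_halfPlane _ (extChartAt_mem_halfPlane x z)),
    ContinuousLinearMap.comp_apply]
  conv_lhs => rw [E2.eq_sum (chartJac x y _ _)]
  simp only [map_add, map_smul]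
  rfl

/-! ### Orientation, integrands and boundary tangent in an arbitrary chart. -/

section Geometry

variable {f n τ : M → E3}

lemma cross_tangentVec_change (hf : ContMDiff (𝓡∂ 2) 𝓘(ℝ, E3) 1 f) {x y z : M}
    (hx : z ∈ (extChartAt (𝓡∂ 2) x).source) (hy : z ∈ (extChartAt (𝓡∂ 2) y).source) :
    cross (tangentVec f x z 0) (tangentVec f x z 1) =
      (chartJac x y (extChartAt (𝓡∂ 2) x z)).det •
        cross (tangentVec f y z 0) (tangentVec f y z 1) := by
  rw [tangentVec_change hf hx hy 0, tangentVec_change hf hx hy 1, cross_comb, det_eq_entries]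

lemma cross_tangentVec_ne_zero (hf : IsRegularSurface f) {x z : M}
    (hx : z ∈ (extChartAt (𝓡∂ 2) x).source) :
    cross (tangentVec f x z 0) (tangentVec f x z 1) ≠ 0 := by
  intro h
  have h1 := cross_tangentVec_change hf.contMDiff_one (mem_extChartAt_source z) hx
  rw [h, smul_zero] at h1
  exact cross_ne_zero_of_linearIndependent (hf.nonsingular z) h1

/-- A zero determinant would annihilate g_0 × g_1, against the regularity of the surface; the
inverse transition map is not needed. -/
lemma det_chartJac_ne_zero (hf : IsRegularSurface f) {x y z : M}
    (hx : z ∈ (extChartAt (𝓡∂ 2) x).source) (hy : z ∈ (extChartAt (𝓡∂ 2) y).source) :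
    (chartJac x y (extChartAt (𝓡∂ 2) x z)).det ≠ 0 := by
  intro h
  have h1 := cross_tangentVec_change hf.contMDiff_one hx hy
  rw [h, zero_smul] at h1
  exact cross_tangentVec_ne_zero hf hx h1

lemma inner_normal_tangentVec (hf : IsRegularSurface f) (hn : IsUnitNormal f n) {x z : M}
    (hx : z ∈ (extChartAt (𝓡∂ 2) x).source) (l : Fin 2) :
    inner ℝ (n z) (tangentVec f x z l) = 0 := by
  rw [tangentVec_change hf.contMDiff_one hx (mem_extChartAt_source z), inner_add_right,
    inner_smul_right, inner_smul_right, ← covBasis_eq_tangentVec, hn.normal, hn.normal]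
  simp

/-- The sign of the orientation of the chart around `x` with respect to the normal field. -/
def chartSign (f n : M → E3) (x z : M) : ℝ :=
  inner ℝ (n z) (cross (tangentVec f x z 0) (tangentVec f x z 1)) /
    ‖cross (tangentVec f x z 0) (tangentVec f x z 1)‖

lemma abs_chartSign (hf : IsRegularSurface f) (hn : IsUnitNormal f n) {x z : M}
    (hx : z ∈ (extChartAt (𝓡∂ 2) x).source) : |chartSign f n x z| = 1 := by
  rw [chartSign, abs_div, abs_norm, abs_inner_normal_cross (hn.norm_eq_one z)
    (inner_normal_tangentVec hf hn hx 0) (inner_normal_tangentVec hf hn hx 1)]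
  exact div_self (norm_ne_zero_iff.2 (cross_tangentVec_ne_zero hf hx))

lemma continuousOn_cross_tangentVec (hf : IsRegularSurface f) (x : M) :
    ContinuousOn (fun z => cross (tangentVec f x z 0) (tangentVec f x z 1))
      (extChartAt (𝓡∂ 2) x).source :=
  (continuousOn_tangentVec hf.contMDiff_one x 0).cross
    (continuousOn_tangentVec hf.contMDiff_one x 1)

lemma continuousOn_chartSign (hf : IsRegularSurface f) (hn : IsUnitNormal f n) (x : M) :
    ContinuousOn (chartSign f n x) (extChartAt (𝓡∂ 2) x).source := by
  have h := continuousOn_cross_tangentVec hf x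
  exact (hn.continuous.continuousOn.inner h).div h.norm
    fun z hz => norm_ne_zero_iff.2 (cross_tangentVec_ne_zero hf hz)

/-- The integrand of the surface integral in the coordinates of any chart. -/
lemma crossNablaOp_eq (hf : IsRegularSurface f) (hn : IsUnitNormal f n)
    (op : E3 →ₗ[ℝ] V →ₗ[ℝ] W) {Φ : M → V} (hΦ : ContMDiff (𝓡∂ 2) 𝓘(ℝ, V) 1 Φ) {x z : M}
    (hx : z ∈ (extChartAt (𝓡∂ 2) x).source) :
    crossNablaOp f n op Φ z =
      (chartSign f n x z / ‖cross (tangentVec f x z 0) (tangentVec f x z 1)‖) •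
        (op (tangentVec f x z 1) (tangentVec Φ x z 0) -
          op (tangentVec f x z 0) (tangentVec Φ x z 1)) := by
  have hz := mem_extChartAt_source (I := 𝓡∂ 2) z
  have hd := det_chartJac_ne_zero hf hx hz
  obtain ⟨h0, h1⟩ := cross_normal_dual (a := covBasis f z) (hn.norm_eq_one z) (hn.normal z)
    (cross_ne_zero_of_linearIndependent (hf.nonsingular z)) (G := metricMatrix f z) rfl
  have hc := cross_tangentVec_change hf.contMDiff_one hx hz
  have hne := cross_tangentVec_ne_zero hf hz
  rw [crossNablaOp, Fin.sum_univ_two, contraBasis, contraBasis, h0, h1, chartSign, hc]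
  -- The expression is alternating in the two coordinate directions, hence it scales by the Jacobian
  -- determinant.
  have hB : op (tangentVec f x z 1) (tangentVec Φ x z 0) -
      op (tangentVec f x z 0) (tangentVec Φ x z 1) =
      (chartJac x z (extChartAt (𝓡∂ 2) x z)).det •
        (op (tangentVec f z z 1) (tangentVec Φ z z 0) -
          op (tangentVec f z z 0) (tangentVec Φ z z 1)) := by
    rw [tangentVec_change hf.contMDiff_one hx hz 0, tangentVec_change hf.contMDiff_one hx hz 1,
      tangentVec_change hΦ hx hz 0, tangentVec_change hΦ hx hz 1, det_eq_entries]
    simp only [map_add, map_smul, LinearMap.add_apply, LinearMap.smul_apply]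
    module
  have hP : ∀ l, partialAt Φ z l = tangentVec Φ z z l := fun _ => rfl
  rw [hB, norm_smul, inner_smul_right, covBasis_eq_tangentVec, hP, hP]
  set J := (chartJac x z (extChartAt (𝓡∂ 2) x z)).det
  set c := cross (tangentVec f z z 0) (tangentVec f z z 1)
  have hc0 : ‖c‖ ≠ 0 := norm_ne_zero_iff.2 hne
  simp only [map_neg, map_smul, LinearMap.neg_apply, LinearMap.smul_apply]
  rw [smul_smul, smul_sub, sub_eq_add_neg]
  -- The numerator carries J twice, from the orientation and from `hB`; the denominator carries |J|
  -- twice, from the two norms. They cancel.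
  have e : J * inner ℝ (n z) c / (‖J‖ * ‖c‖) / (‖J‖ * ‖c‖) * J = inner ℝ (n z) c / ‖c‖ ^ 2 := by
    have : ‖J‖ * ‖J‖ = J * J := by rw [Real.norm_eq_abs, abs_mul_abs_self]
    have hJ0 : ‖J‖ ≠ 0 := norm_ne_zero_iff.2 hd
    field_simp
    rw [sq, sq, this]
    ring
  rw [e]

/-- The surface integrand is continuous. -/
lemma continuous_crossNablaOp [FiniteDimensional ℝ V] (hf : IsRegularSurface f)
    (hn : IsUnitNormal f n) (op : E3 →ₗ[ℝ] V →ₗ[ℝ] W) {Φ : M → V}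
    (hΦ : ContMDiff (𝓡∂ 2) 𝓘(ℝ, V) 1 Φ) : Continuous (crossNablaOp f n op Φ) := by
  rw [continuous_iff_continuousAt]
  intro x
  have hc := continuousOn_cross_tangentVec hf x
  have hop : ∀ l k, ContinuousOn (fun z => op (tangentVec f x z l) (tangentVec Φ x z k))
      (extChartAt (𝓡∂ 2) x).source := fun l k =>
    op.continuous_uncurried.comp_continuousOn
      ((continuousOn_tangentVec hf.contMDiff_one x l).prodMk (continuousOn_tangentVec hΦ x k))
  have h : ContinuousOn (crossNablaOp f n op Φ) (extChartAt (𝓡∂ 2) x).source :=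
    (((continuousOn_chartSign hf hn x).div hc.norm
      fun z hz => norm_ne_zero_iff.2 (cross_tangentVec_ne_zero hf hz)).smul
        ((hop 1 0).sub (hop 0 1))).congr fun z hz => crossNablaOp_eq hf hn op hΦ hz
  exact h.continuousAt (extChartAt_source_mem_nhds x)

/-- Interior points are recognized by any chart of a smooth atlas, so any chart can test membership
in the boundary. -/
lemma mem_boundary_iff {x z : M} (hx : z ∈ (extChartAt (𝓡∂ 2) x).source) :
    z ∈ (𝓡∂ 2).boundary M ↔ extChartAt (𝓡∂ 2) x z 0 = 0 := by
  have hc : z ∈ (chartAt (EuclideanHalfSpace 2) x).source := by rwa [extChartAt_source] at hx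
  have h := (𝓡∂ 2).isInteriorPoint_iff_of_mem_atlas (n := ∞) (by simp)
    (chart_mem_atlas (EuclideanHalfSpace 2) x) hc
  have hint : (𝓡∂ 2).IsInteriorPoint z ↔ 0 < extChartAt (𝓡∂ 2) x z 0 := by
    refine h.trans ⟨fun hz => ?_, fun hz => ?_⟩
    · have := interior_mono (extChartAt_target_subset_range (I := 𝓡∂ 2) x) hz
      rwa [interior_range_modelWithCornersEuclideanHalfSpace] at this
    · refine mem_interior_iff_mem_nhds.2 ?_
      have h1 := extChartAt_target_mem_nhdsWithin' hx
      rwa [nhdsWithin_eq_nhds.2 (halfPlane_mem_nhds hz)] at h1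
  have hnn := mem_halfPlane.1 (extChartAt_mem_halfPlane x z)
  refine ((𝓡∂ 2).isBoundaryPoint_iff_not_isInteriorPoint z).trans ?_
  rw [hint, not_lt]
  exact ⟨fun h => le_antisymm h hnn, fun h => h.le⟩

/-- At a boundary point the change of charts preserves the inward direction and the boundary. -/
lemma chartJac_boundary (hf : IsRegularSurface f) {x y z : M}
    (hx : z ∈ (extChartAt (𝓡∂ 2) x).source) (hy : z ∈ (extChartAt (𝓡∂ 2) y).source)
    (hz : z ∈ (𝓡∂ 2).boundary M) :
    chartJac x y (extChartAt (𝓡∂ 2) x z) (EuclideanSpace.single 1 1) 0 = 0 ∧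
      0 < chartJac x y (extChartAt (𝓡∂ 2) x z) (EuclideanSpace.single 0 1) 0 := by
  set u := extChartAt (𝓡∂ 2) x z with hu
  have hu0 : u 0 = 0 := (mem_boundary_iff hx).1 hz
  have hv0 : extChartAt (𝓡∂ 2) y z 0 = 0 := (mem_boundary_iff hy).1 hz
  have hJ := hasFDerivWithinAt_chartJac hx hy
  rw [← hu] at hJ
  have hJ0 := (EuclideanSpace.proj (0 : Fin 2) : E2 →L[ℝ] ℝ).hasFDerivAt.comp_hasFDerivWithinAt u hJ
  -- The coordinate x⁰ of the new chart is nonnegative and vanishes at the point: a minimum on the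
  -- half-plane, so its derivative is nonnegative in every direction w with w⁰ ≥ 0.
  have hmin : IsLocalMinOn ((EuclideanSpace.proj (0 : Fin 2) : E2 →L[ℝ] ℝ) ∘
      (extChartAt (𝓡∂ 2) y ∘ (extChartAt (𝓡∂ 2) x).symm)) halfPlane u := by
    refine Filter.Eventually.of_forall fun v => ?_
    have h1 : (EuclideanSpace.proj (0 : Fin 2) : E2 →L[ℝ] ℝ)
        (extChartAt (𝓡∂ 2) y ((extChartAt (𝓡∂ 2) x).symm u)) = 0 := by
      rw [hu, (extChartAt (𝓡∂ 2) x).left_inv hx]; exact hv0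
    simp only [Function.comp_apply]
    rw [h1]
    exact mem_halfPlane.1 (extChartAt_mem_halfPlane y _)
  have hcone : ∀ w : E2, 0 ≤ w 0 → w ∈ posTangentConeAt halfPlane u := by
    intro w hw
    refine mem_posTangentConeAt_of_segment_subset ?_
    intro v hv
    rw [segment_eq_image'] at hv
    obtain ⟨θ, hθ, rfl⟩ := hv
    rw [mem_halfPlane]
    simp [hu0, mul_nonneg hθ.1 hw]
  have hnn : ∀ w : E2, 0 ≤ w 0 → 0 ≤ chartJac x y u w 0 := fun w hw =>
    hmin.hasFDerivWithinAt_nonneg hJ0 (hcone w hw)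
  have h1 : chartJac x y u (EuclideanSpace.single 1 1) 0 = 0 := by
    refine le_antisymm ?_ (hnn _ (by simp))
    -- Both directions along the edge are admissible.
    have := hnn (-EuclideanSpace.single 1 1) (by simp)
    simpa using this
  refine ⟨h1, lt_of_le_of_ne (hnn _ (by simp)) fun h0 => ?_⟩
  -- If the inward derivative vanished too, a whole row of the Jacobian would be zero.
  have hdet := det_chartJac_ne_zero hf hx hy
  rw [← hu, det_eq_entries, h1, ← h0] at hdet
  simp at hdet

/-- The boundary tangent in the coordinates of any chart. -/
lemma norm_smul_tangent_eq (hf : IsRegularSurface f) (hn : IsUnitNormal f n)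
    (hτ : IsBoundaryTangent f n τ) {x z : M} (hx : z ∈ (extChartAt (𝓡∂ 2) x).source)
    (hz : z ∈ (𝓡∂ 2).boundary M) :
    ‖tangentVec f x z 1‖ • τ z = -(chartSign f n x z • tangentVec f x z 1) := by
  have hzz := mem_extChartAt_source (I := 𝓡∂ 2) z
  obtain ⟨c, hc⟩ := hτ.tangent z hz
  obtain ⟨a, b, ha, hab⟩ := hτ.inward z hz
  obtain ⟨h10, h00⟩ := chartJac_boundary hf hzz hx hz
  have e0 := tangentVec_change hf.contMDiff_one hzz hx 0
  have e1 := tangentVec_change hf.contMDiff_one hzz hx 1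
  -- Passing to the chart around `x`, g_1 stays tangent to the edge and g_0 keeps a positive inward
  -- component, so both tangent conditions persist.
  rw [h10, zero_smul, zero_add] at e1
  rw [covBasis_eq_tangentVec, e1] at hc hab
  rw [e0] at hab
  refine unit_tangent_eq (hn.norm_eq_one z) (inner_normal_tangentVec hf hn hx 0)
    (inner_normal_tangentVec hf hn hx 1) (cross_tangentVec_ne_zero hf hx) (hτ.norm_eq_one z hz)
    (c := c * chartJac z x (extChartAt (𝓡∂ 2) z z) (EuclideanSpace.single 1 1) 1)
    (by rw [hc, smul_smul]) (mul_pos ha h00)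
    (q := a * chartJac z x (extChartAt (𝓡∂ 2) z z) (EuclideanSpace.single 0 1) 1 +
      b * chartJac z x (extChartAt (𝓡∂ 2) z z) (EuclideanSpace.single 1 1) 1) ?_
  rw [hab]
  module

lemma tangentVec_one_ne_zero (hf : IsRegularSurface f) {x z : M}
    (hx : z ∈ (extChartAt (𝓡∂ 2) x).source) : tangentVec f x z 1 ≠ 0 := by
  intro h
  have := cross_smul_right 0 (tangentVec f x z 0) 0
  refine cross_tangentVec_ne_zero hf hx ?_
  rw [h]
  simpa using this

/-- Continuity of τ is not assumed: on the boundary its conditions force τ = −ε g_1 / |g_1|. -/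
lemma continuousOn_tangent (hf : IsRegularSurface f) (hn : IsUnitNormal f n)
    (hτ : IsBoundaryTangent f n τ) : ContinuousOn τ ((𝓡∂ 2).boundary M) := by
  intro x hxb
  have h1 := continuousOn_tangentVec hf.contMDiff_one x 1
  have h : ContinuousOn (fun z => -((chartSign f n x z / ‖tangentVec f x z 1‖) •
      tangentVec f x z 1)) (extChartAt (𝓡∂ 2) x).source :=
    (((continuousOn_chartSign hf hn x).div h1.norm
      fun z hz => norm_ne_zero_iff.2 (tangentVec_one_ne_zero hf hz)).smul h1).neg
  have h2 := h.continuousAt (extChartAt_source_mem_nhds x)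
  refine h2.continuousWithinAt.congr_of_eventuallyEq_of_mem ?_ hxb
  filter_upwards [self_mem_nhdsWithin, nhdsWithin_le_nhds (extChartAt_source_mem_nhds (I := 𝓡∂ 2) x)]
    with z hzb hz
  have e := norm_smul_tangent_eq hf hn hτ hz hzb
  have hne := norm_ne_zero_iff.2 (tangentVec_one_ne_zero hf hz)
  rw [div_eq_inv_mul, mul_smul, ← smul_neg, ← e, smul_smul, inv_mul_cancel₀ hne, one_smul]

end Geometry
end

/-! ### The area and length measures in a chart, and their finiteness. -/

section

variable {M : Type*} [TopologicalSpace M] [ChartedSpace (EuclideanHalfSpace 2) M]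

lemma measurableSet_extChartAt_target (x : M) : MeasurableSet (extChartAt (𝓡∂ 2) x).target := by
  rw [extChartAt_target]
  exact (((chartAt (EuclideanHalfSpace 2) x).open_target.preimage
    (𝓡∂ 2).continuous_symm).measurableSet).inter isClosed_halfPlane.measurableSet

/-- The parameters of the edge of the coordinate domain of the chart around `x`. -/
def edgeDomain (x : M) : Set ℝ := {t : ℝ | !₂[0, t] ∈ (extChartAt (𝓡∂ 2) x).target}

/-- The boundary curve in the coordinates of the chart around `x`. -/
def edgeCurve (x : M) (t : ℝ) : M := (extChartAt (𝓡∂ 2) x).symm !₂[0, t]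

lemma edgePoint_eq (t : ℝ) : (!₂[0, t] : E2) =
    ContinuousLinearMap.toSpanSingleton ℝ (EuclideanSpace.single 1 1 : E2) t := by
  ext i; fin_cases i <;> simp

lemma continuous_edgePoint : Continuous fun t : ℝ => (!₂[0, t] : E2) := by
  simp only [edgePoint_eq]
  exact ContinuousLinearMap.continuous _

lemma measurableSet_edgeDomain (x : M) : MeasurableSet (edgeDomain x) :=
  continuous_edgePoint.measurable (measurableSet_extChartAt_target x)

lemma continuousOn_edgeCurve (x : M) : ContinuousOn (edgeCurve x) (edgeDomain x) :=
  (continuousOn_extChartAt_symm x).comp continuous_edgePoint.continuousOn fun _ ht => ht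

lemma edgeCurve_mem_source {x : M} {t : ℝ} (ht : t ∈ edgeDomain x) :
    edgeCurve x t ∈ (extChartAt (𝓡∂ 2) x).source := (extChartAt (𝓡∂ 2) x).map_target ht

lemma extChartAt_edgeCurve {x : M} {t : ℝ} (ht : t ∈ edgeDomain x) :
    extChartAt (𝓡∂ 2) x (edgeCurve x t) = !₂[0, t] := (extChartAt (𝓡∂ 2) x).right_inv ht

lemma chartArea_eq_paramMeasure [MeasurableSpace M] (f : M → E3) (x : M) : chartArea f x =
    paramMeasure (extChartAt (𝓡∂ 2) x).symm (extChartAt (𝓡∂ 2) x).target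
      fun u => ‖cross (partialDeriv x f u 0) (partialDeriv x f u 1)‖ := rfl

lemma chartLength_eq_paramMeasure [MeasurableSpace M] (f : M → E3) (x : M) : chartLength f x =
    paramMeasure (edgeCurve x) (edgeDomain x) fun t => ‖partialDeriv x f !₂[0, t] 1‖ := rfl

variable [IsManifold (𝓡∂ 2) ∞ M] {f : M → E3}

lemma edgeCurve_mem_boundary {x : M} {t : ℝ} (ht : t ∈ edgeDomain x) :
    edgeCurve x t ∈ (𝓡∂ 2).boundary M := by
  rw [mem_boundary_iff (edgeCurve_mem_source ht), extChartAt_edgeCurve ht]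
  rfl

lemma continuousOn_areaDensity (hf : IsRegularSurface f) (x : M) :
    ContinuousOn (fun u => ‖cross (partialDeriv x f u 0) (partialDeriv x f u 1)‖)
      (extChartAt (𝓡∂ 2) x).target :=
  ((continuousOn_partialDeriv hf.contMDiff_one x 0).cross
    (continuousOn_partialDeriv hf.contMDiff_one x 1)).norm

lemma continuousOn_lengthDensity (hf : IsRegularSurface f) (x : M) :
    ContinuousOn (fun t : ℝ => ‖partialDeriv x f !₂[0, t] 1‖) (edgeDomain x) :=
  ((continuousOn_partialDeriv hf.contMDiff_one x 1).comp continuous_edgePoint.continuousOn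
    fun _ ht => ht).norm

variable [MeasurableSpace M] [BorelSpace M]

/-- On overlaps |g_0 × g_1| is multiplied by |det| of the transition map, as change of variables
requires. -/
lemma areaMeasure_restrict (hf : IsRegularSurface f) (x : M) :
    (areaMeasure f).restrict (extChartAt (𝓡∂ 2) x).source = chartArea f x := by
  refine Measure.iSup_restrict_eq (m := chartArea f)
    (U := fun x => (extChartAt (𝓡∂ 2) x).source)
    (fun y => (isOpen_extChartAt_source y).measurableSet) (fun y => ?_) (fun y w A hA hAU => ?_) x
  · exact paramMeasure_compl_eq_zero (measurableSet_extChartAt_target y)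
      (continuousOn_extChartAt_symm y) (isOpen_extChartAt_source y).measurableSet
      fun u hu => (extChartAt (𝓡∂ 2) y).map_target hu
  · have hS : ∀ u ∈ (extChartAt (𝓡∂ 2) y).target, (extChartAt (𝓡∂ 2) y).symm u ∈ A →
        (extChartAt (𝓡∂ 2) y).symm u ∈ (extChartAt (𝓡∂ 2) y).source ∧
        (extChartAt (𝓡∂ 2) y).symm u ∈ (extChartAt (𝓡∂ 2) w).source := fun u _ hA => hAU hA
    refine paramMeasure_le_of_change (measurableSet_extChartAt_target y)
      (continuousOn_extChartAt_symm y) (measurableSet_extChartAt_target w)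
      (continuousOn_extChartAt_symm w) hA
      (φ := extChartAt (𝓡∂ 2) w ∘ (extChartAt (𝓡∂ 2) y).symm) (J := chartJac y w) ?_ ?_ ?_ ?_
    · intro u hu huA
      have h := (hS u hu huA).2
      exact ⟨(extChartAt (𝓡∂ 2) w).map_source h, (extChartAt (𝓡∂ 2) w).left_inv h⟩
    · intro u hu v hv huv
      have h1 := (extChartAt (𝓡∂ 2) w).injOn (hS u hu.1 hu.2).2 (hS v hv.1 hv.2).2 huv
      exact (extChartAt (𝓡∂ 2) y).symm.injOn hu.1 hv.1 h1
    · intro u hu huA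
      have h := hS u hu huA
      have := hasFDerivWithinAt_chartJac h.1 h.2
      rw [(extChartAt (𝓡∂ 2) y).right_inv hu] at this
      exact this.mono (extChartAt_target_subset_range y)
    · intro u hu huA
      have h := hS u hu huA
      have := cross_tangentVec_change hf.contMDiff_one h.1 h.2
      simp only [tangentVec, (extChartAt (𝓡∂ 2) y).right_inv hu] at this
      simp only [Function.comp_apply]
      rw [this, norm_smul, Real.norm_eq_abs]

/-- Transition maps send edge to edge. Along the edge g_1 is only rescaled, by `chartJac_boundary`,
and the factor is the derivative of the one-dimensional change of parameter. -/
lemma lengthMeasure_restrict (hf : IsRegularSurface f) (x : M) :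
    (lengthMeasure f).restrict (extChartAt (𝓡∂ 2) x).source = chartLength f x := by
  refine Measure.iSup_restrict_eq (m := chartLength f)
    (U := fun x => (extChartAt (𝓡∂ 2) x).source)
    (fun y => (isOpen_extChartAt_source y).measurableSet) (fun y => ?_) (fun y w A hA hAU => ?_) x
  · exact paramMeasure_compl_eq_zero (measurableSet_edgeDomain y)
      (continuousOn_edgeCurve y) (isOpen_extChartAt_source y).measurableSet
      fun u hu => edgeCurve_mem_source hu
  · have hS : ∀ t ∈ edgeDomain y, edgeCurve y t ∈ A →
        edgeCurve y t ∈ (extChartAt (𝓡∂ 2) y).source ∧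
        edgeCurve y t ∈ (extChartAt (𝓡∂ 2) w).source := fun u _ hA => hAU hA
    have hφ : ∀ t ∈ edgeDomain y, edgeCurve y t ∈ A →
        (!₂[0, extChartAt (𝓡∂ 2) w (edgeCurve y t) 1] : E2) =
          extChartAt (𝓡∂ 2) w (edgeCurve y t) := by
      intro t ht htA
      have h0 := (mem_boundary_iff (hS t ht htA).2).1 (edgeCurve_mem_boundary ht)
      ext i
      fin_cases i
      · simpa using h0.symm
      · rfl
    refine paramMeasure_le_of_change (measurableSet_edgeDomain y)
      (continuousOn_edgeCurve y) (measurableSet_edgeDomain w)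
      (continuousOn_edgeCurve w) hA
      (φ := fun t => extChartAt (𝓡∂ 2) w (edgeCurve y t) 1)
      (J := fun t => (EuclideanSpace.proj (1 : Fin 2) : E2 →L[ℝ] ℝ).comp
        ((chartJac y w !₂[0, t]).comp
          (ContinuousLinearMap.toSpanSingleton ℝ (EuclideanSpace.single 1 1 : E2)))) ?_ ?_ ?_ ?_
    · intro t ht htA
      have h := (hS t ht htA).2
      refine ⟨?_, ?_⟩
      · rw [edgeDomain, mem_ofPred_eq, hφ t ht htA]
        exact (extChartAt (𝓡∂ 2) w).map_source h
      · rw [edgeCurve, hφ t ht htA]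
        exact (extChartAt (𝓡∂ 2) w).left_inv h
    · intro u hu v hv huv
      have h2 : extChartAt (𝓡∂ 2) w (edgeCurve y u) = extChartAt (𝓡∂ 2) w (edgeCurve y v) := by
        rw [← hφ u hu.1 hu.2, ← hφ v hv.1 hv.2]
        simp only at huv
        rw [huv]
      have h1 := (extChartAt (𝓡∂ 2) w).injOn (hS u hu.1 hu.2).2 (hS v hv.1 hv.2).2 h2
      have h3 := (extChartAt (𝓡∂ 2) y).symm.injOn hu.1 hv.1 h1
      simpa using congrArg (fun q : E2 => q 1) h3
    · intro t ht htA
      have h := hS t ht htA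
      have hJ := hasFDerivWithinAt_chartJac h.1 h.2
      rw [extChartAt_edgeCurve ht, edgePoint_eq] at hJ
      have hline := (ContinuousLinearMap.toSpanSingleton ℝ
        (EuclideanSpace.single 1 1 : E2)).hasFDerivWithinAt (s := edgeDomain y) (x := t)
      have hc := hJ.comp t hline fun s hs => by
        rw [← edgePoint_eq]; exact extChartAt_target_subset_range y hs
      have hp := (EuclideanSpace.proj (1 : Fin 2) : E2 →L[ℝ] ℝ).hasFDerivAt.comp_hasFDerivWithinAt
        t hc
      rw [← edgePoint_eq] at hp
      refine hp.congr (fun s _ => ?_) ?_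
      · simp only [Function.comp_apply, ← edgePoint_eq]; rfl
      · simp only [Function.comp_apply, ← edgePoint_eq]; rfl
    · intro t ht htA
      have h := hS t ht htA
      have hb := (edgeCurve_mem_boundary ht)
      have h1 := tangentVec_change hf.contMDiff_one h.1 h.2 1
      rw [(chartJac_boundary hf h.1 h.2 hb).1, zero_smul, zero_add] at h1
      simp only [tangentVec, extChartAt_edgeCurve ht] at h1
      rw [hφ t ht htA, h1, norm_smul, Real.norm_eq_abs, ContinuousLinearMap.det,
        LinearMap.det_ring]
      simp

/-- Needed because τ is controlled on the boundary only. -/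
lemma lengthMeasure_restrict_boundary :
    (lengthMeasure f).restrict ((𝓡∂ 2).boundary M) = lengthMeasure f := by
  have hB : MeasurableSet ((𝓡∂ 2).boundary M) :=
    ((𝓡∂ 2).isClosed_boundary (n := ∞) (by simp)).measurableSet
  refine le_antisymm Measure.restrict_le_self (iSup_le fun x => ?_)
  have h0 : chartLength f x ((𝓡∂ 2).boundary M)ᶜ = 0 :=
    paramMeasure_compl_eq_zero (measurableSet_edgeDomain x) (continuousOn_edgeCurve x) hB
      fun t ht => edgeCurve_mem_boundary ht
  have h1 : (chartLength f x).restrict ((𝓡∂ 2).boundary M) = chartLength f x := by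
    rw [Measure.restrict_eq_self_of_ae_mem]
    exact h0
  rw [← h1]
  exact Measure.restrict_mono subset_rfl (le_iSup (chartLength f) x)

lemma isFiniteMeasure_areaMeasure [CompactSpace M] (hf : IsRegularSurface f) :
    IsFiniteMeasure (areaMeasure f) := by
  have : IsLocallyFiniteMeasure (areaMeasure f) := by
    refine ⟨fun x => ?_⟩
    obtain ⟨r, hr, h⟩ := exists_paramMeasure_lt_top (measurableSet_extChartAt_target x)
      (continuousOn_extChartAt_symm x) (continuousOn_areaDensity hf x) (mem_extChartAt_target x)
    have hN := isOpen_extChartAt_preimage' (I := 𝓡∂ 2) x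
      (Metric.isOpen_ball (x := extChartAt (𝓡∂ 2) x x) (ε := r))
    refine ⟨_, hN.mem_nhds ⟨mem_extChartAt_source x, Metric.mem_ball_self hr⟩, ?_⟩
    rw [← Measure.restrict_eq_self _ inter_subset_left, areaMeasure_restrict hf x]
    refine h _ hN.measurableSet fun u hu huA => ?_
    have := huA.2
    rwa [mem_preimage, (extChartAt (𝓡∂ 2) x).right_inv hu] at this
  exact CompactSpace.isFiniteMeasure

lemma isFiniteMeasure_lengthMeasure [CompactSpace M] (hf : IsRegularSurface f) :
    IsFiniteMeasure (lengthMeasure f) := by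
  have : IsLocallyFiniteMeasure (lengthMeasure f) := by
    refine ⟨fun x => ?_⟩
    by_cases hx : x ∈ (𝓡∂ 2).boundary M
    · have hx0 := (mem_boundary_iff (mem_extChartAt_source x)).1 hx
      have hpt : (!₂[0, extChartAt (𝓡∂ 2) x x 1] : E2) = extChartAt (𝓡∂ 2) x x := by
        ext i
        fin_cases i
        · simpa using hx0.symm
        · rfl
      have hmem : extChartAt (𝓡∂ 2) x x 1 ∈ edgeDomain x := by
        rw [edgeDomain, mem_ofPred_eq, hpt]
        exact mem_extChartAt_target x
      obtain ⟨r, hr, h⟩ := exists_paramMeasure_lt_top (measurableSet_edgeDomain x)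
        (continuousOn_edgeCurve x) (continuousOn_lengthDensity hf x) hmem
      have hN := isOpen_extChartAt_preimage' (I := 𝓡∂ 2) x
        (Metric.isOpen_ball (x := extChartAt (𝓡∂ 2) x x) (ε := r))
      refine ⟨_, hN.mem_nhds ⟨mem_extChartAt_source x, Metric.mem_ball_self hr⟩, ?_⟩
      rw [← Measure.restrict_eq_self _ inter_subset_left, lengthMeasure_restrict hf x]
      refine h _ hN.measurableSet fun t ht htA => ?_
      have h1 := htA.2
      rw [mem_preimage, extChartAt_edgeCurve ht, mem_ball_iff_norm] at h1
      rw [mem_ball_iff_norm]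
      exact lt_of_le_of_lt (PiLp.norm_apply_le (!₂[0, t] - extChartAt (𝓡∂ 2) x x) 1) h1
    -- At an interior point the complement of the boundary is an open neighbourhood of length zero.
    · refine ⟨((𝓡∂ 2).boundary M)ᶜ, ((𝓡∂ 2).isClosed_boundary (n := ∞)
        (by simp)).isOpen_compl.mem_nhds hx, ?_⟩
      rw [← lengthMeasure_restrict_boundary, Measure.restrict_apply
        ((𝓡∂ 2).isClosed_boundary (n := ∞) (by simp)).isOpen_compl.measurableSet,
        compl_inter_self, measure_empty]
      exact ENNReal.zero_lt_top
  exact CompactSpace.isFiniteMeasure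

variable {W : Type*} [NormedAddCommGroup W] [NormedSpace ℝ W]

/-- Surface integrals of fields that vanish outside of a chart. -/
lemma integral_areaMeasure_eq (hf : IsRegularSurface f) (x : M) {F : M → W}
    (hF : AEStronglyMeasurable F (areaMeasure f))
    (hs : ∀ z ∉ (extChartAt (𝓡∂ 2) x).source, F z = 0) :
    ∫ z, F z ∂(areaMeasure f) = ∫ u in (extChartAt (𝓡∂ 2) x).target,
      ‖cross (partialDeriv x f u 0) (partialDeriv x f u 1)‖ •
        F ((extChartAt (𝓡∂ 2) x).symm u) := by
  rw [← setIntegral_eq_integral_of_forall_compl_eq_zero hs, areaMeasure_restrict hf x,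
    chartArea_eq_paramMeasure]
  refine integral_paramMeasure (measurableSet_extChartAt_target x)
    (continuousOn_extChartAt_symm x) (continuousOn_areaDensity hf x) (fun _ => norm_nonneg _) ?_
  rw [← chartArea_eq_paramMeasure, ← areaMeasure_restrict hf x]
  exact hF.restrict

/-- Curve integrals of fields that vanish outside of a chart. -/
lemma integral_lengthMeasure_eq (hf : IsRegularSurface f) (x : M) {F : M → W}
    (hF : AEStronglyMeasurable F (lengthMeasure f))
    (hs : ∀ z ∉ (extChartAt (𝓡∂ 2) x).source, F z = 0) :
    ∫ z, F z ∂(lengthMeasure f) = ∫ t in edgeDomain x,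
      ‖partialDeriv x f !₂[0, t] 1‖ • F (edgeCurve x t) := by
  rw [← setIntegral_eq_integral_of_forall_compl_eq_zero hs, lengthMeasure_restrict hf x,
    chartLength_eq_paramMeasure]
  refine integral_paramMeasure (measurableSet_edgeDomain x)
    (continuousOn_edgeCurve x) (continuousOn_lengthDensity hf x) (fun _ => norm_nonneg _) ?_
  rw [← chartLength_eq_paramMeasure, ← lengthMeasure_restrict hf x]
  exact hF.restrict

end

/-! ### Stokes' formula for fields supported in a chart. -/

section

variable {M : Type*} [TopologicalSpace M] [ChartedSpace (EuclideanHalfSpace 2) M]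

lemma isCompact_image_tsupport {V : Type*} [Zero V] {Φ : M → V} {x : M} [CompactSpace M]
    (hs : tsupport Φ ⊆ (extChartAt (𝓡∂ 2) x).source) :
    IsCompact (extChartAt (𝓡∂ 2) x '' tsupport Φ) :=
  (isClosed_tsupport Φ).isCompact.image_of_continuousOn ((continuousOn_extChartAt x).mono hs)

variable {V : Type*} [NormedAddCommGroup V] [NormedSpace ℝ V]
  {W : Type*} [NormedAddCommGroup W] [NormedSpace ℝ W] {f n τ : M → E3}

lemma tangentVec_eq_zero_of_notMem_tsupport {Φ : M → V} {x z : M}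
    (hx : z ∈ (extChartAt (𝓡∂ 2) x).source) (hz : z ∉ tsupport Φ) (l : Fin 2) :
    tangentVec Φ x z l = 0 := by
  have h1 : ContinuousAt (extChartAt (𝓡∂ 2) x).symm (extChartAt (𝓡∂ 2) x z) :=
    continuousAt_extChartAt_symm' hx
  have h2 : Φ ∘ (extChartAt (𝓡∂ 2) x).symm =ᶠ[nhdsWithin (extChartAt (𝓡∂ 2) x z) halfPlane]
      fun _ => 0 := by
    have h3 := h1.preimage_mem_nhds ((isClosed_tsupport Φ).isOpen_compl.mem_nhds
      (by rw [(extChartAt (𝓡∂ 2) x).left_inv hx]; exact hz))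
    filter_upwards [nhdsWithin_le_nhds h3] with u hu
    exact image_eq_zero_of_notMem_tsupport (f := Φ) hu
  rw [tangentVec, partialDeriv, h2.fderivWithin_eq_of_mem (extChartAt_mem_halfPlane x z)]
  simp

lemma crossNablaOp_eq_zero_of_notMem_tsupport (op : E3 →ₗ[ℝ] V →ₗ[ℝ] W) {Φ : M → V} {z : M}
    (hz : z ∉ tsupport Φ) : crossNablaOp f n op Φ z = 0 := by
  refine Finset.sum_eq_zero fun l _ => ?_
  have h : partialAt Φ z l = 0 :=
    tangentVec_eq_zero_of_notMem_tsupport (mem_extChartAt_source z) hz l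
  rw [h, map_zero]

/-- The field `g_l ∘ Φ` in the chart around `x`, extended by zero. -/
def chartField (op : E3 →L[ℝ] V →L[ℝ] W) (f : M → E3) (Φ : M → V) (x : M) (l : Fin 2) : E2 → W :=
  (extChartAt (𝓡∂ 2) x).target.indicator fun u =>
    op (partialDeriv x f u l) (Φ ((extChartAt (𝓡∂ 2) x).symm u))

section

variable {op : E3 →L[ℝ] V →L[ℝ] W} {Φ : M → V} {x : M}

lemma chartField_eventuallyEq {u : E2} (hu : u ∈ (extChartAt (𝓡∂ 2) x).target) (l : Fin 2) :
    chartField op f Φ x l =ᶠ[nhdsWithin u halfPlane] fun u =>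
      op (partialDeriv x f u l) ((Φ ∘ (extChartAt (𝓡∂ 2) x).symm) u) := by
  filter_upwards [extChartAt_target_mem_nhdsWithin_of_mem hu] with v hv
  rw [chartField, indicator_of_mem hv]
  rfl

lemma chartField_eq_zero {u : E2} (hu : u ∉ extChartAt (𝓡∂ 2) x '' tsupport Φ) (l : Fin 2) :
    chartField op f Φ x l u = 0 := by
  by_cases h : u ∈ (extChartAt (𝓡∂ 2) x).target
  · rw [chartField, indicator_of_mem h, image_eq_zero_of_notMem_tsupport (f := Φ)
      fun hz => hu ⟨_, hz, (extChartAt (𝓡∂ 2) x).right_inv h⟩, map_zero]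
  · rw [chartField, indicator_of_notMem h]

/-- The image of the support is compact, hence closed in the whole plane, and misses `u`. So the
extension by zero creates no singularity at the frontier of the coordinate domain. -/
lemma chartField_eventuallyEq_zero [CompactSpace M]
    (hs : tsupport Φ ⊆ (extChartAt (𝓡∂ 2) x).source) {u : E2}
    (hu : u ∉ (extChartAt (𝓡∂ 2) x).target) (l : Fin 2) :
    chartField op f Φ x l =ᶠ[nhds u] fun _ => 0 := by
  have hK := (isCompact_image_tsupport hs).isClosed.isOpen_compl
  have hu' : u ∉ extChartAt (𝓡∂ 2) x '' tsupport Φ := by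
    rintro ⟨z, hz, rfl⟩
    exact hu ((extChartAt (𝓡∂ 2) x).map_source (hs hz))
  filter_upwards [hK.mem_nhds hu'] with v hv
  exact chartField_eq_zero hv l

variable [IsManifold (𝓡∂ 2) ∞ M]

lemma contDiffWithinAt_fderivWithin_position (hf : IsRegularSurface f) {u : E2}
    (hu : u ∈ (extChartAt (𝓡∂ 2) x).target) :
    ContDiffWithinAt ℝ 1 (fderivWithin ℝ (f ∘ (extChartAt (𝓡∂ 2) x).symm) halfPlane)
      halfPlane u :=
  (contDiffWithinAt_comp_symm (m := 2) (hf.smooth.of_le (by exact_mod_cast le_top))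
    x hu).fderivWithin_right uniqueDiffOn_halfPlane (by norm_num)
      (extChartAt_target_subset_range x hu)

lemma contDiffOn_chartField [CompactSpace M] (hf : IsRegularSurface f)
    (hΦ : ContMDiff (𝓡∂ 2) 𝓘(ℝ, V) 1 Φ)
    (hs : tsupport Φ ⊆ (extChartAt (𝓡∂ 2) x).source) (l : Fin 2) :
    ContDiffOn ℝ 1 (chartField op f Φ x l) halfPlane := by
  intro u huH
  by_cases hu : u ∈ (extChartAt (𝓡∂ 2) x).target
  · have h1 := contDiffWithinAt_fderivWithin_position hf hu
    have h2 : ContDiffWithinAt ℝ 1 (Φ ∘ (extChartAt (𝓡∂ 2) x).symm) halfPlane u :=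
      contDiffWithinAt_comp_symm (m := 1) hΦ x hu
    have h3 : ContDiffWithinAt ℝ 1 (fun u => partialDeriv x f u l) halfPlane u :=
      h1.clm_apply contDiffWithinAt_const
    exact ((contDiffWithinAt_const.clm_apply h3).clm_apply h2).congr_of_eventuallyEq_of_mem
      (chartField_eventuallyEq hu l) huH
  · have h := (chartField_eventuallyEq_zero (op := op) (f := f) hs hu l).filter_mono
      (nhdsWithin_le_nhds (s := halfPlane))
    exact contDiffWithinAt_const.congr_of_eventuallyEq_of_mem h huH

/-- Product rule; the second-derivative term is kept in a form whose symmetry in `l`, `k` makes it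
drop out of the curl. -/
lemma fderivWithin_chartField (hf : IsRegularSurface f)
    (hΦ : ContMDiff (𝓡∂ 2) 𝓘(ℝ, V) 1 Φ) {u : E2} (hu : u ∈ (extChartAt (𝓡∂ 2) x).target)
    (l k : Fin 2) :
    fderivWithin ℝ (chartField op f Φ x l) halfPlane u (EuclideanSpace.single k 1) =
      op (partialDeriv x f u l) (partialDeriv x Φ u k) +
      op (fderivWithin ℝ (fderivWithin ℝ (f ∘ (extChartAt (𝓡∂ 2) x).symm) halfPlane) halfPlane u
        (EuclideanSpace.single k 1) (EuclideanSpace.single l 1))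
        (Φ ((extChartAt (𝓡∂ 2) x).symm u)) := by
  have huH := extChartAt_target_subset_range x hu
  have h1 := ((contDiffWithinAt_fderivWithin_position hf hu).differentiableWithinAt
    one_ne_zero).hasFDerivWithinAt.clm_apply
    (hasFDerivWithinAt_const (EuclideanSpace.single l (1 : ℝ)) u halfPlane)
  have h2 := (differentiableWithinAt_comp_symm hΦ x hu).hasFDerivWithinAt
  have h3 := op.hasFDerivWithinAt_of_bilinear h1 h2
  rw [(chartField_eventuallyEq hu l).fderivWithin_eq_of_mem huH]
  refine (congrArg (fun L : E2 →L[ℝ] W => L (EuclideanSpace.single k 1))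
    (h3.fderivWithin (uniqueDiffOn_halfPlane u huH))).trans ?_
  simp only [partialDeriv, add_apply, ContinuousLinearMap.precompR_apply,
    ContinuousLinearMap.precompL_apply, ContinuousLinearMap.comp_zero, zero_add,
    ContinuousLinearMap.flip_apply, Function.comp_apply]
  rfl

/-- The curl of the field `g_l ∘ Φ`: the second derivatives of the position vector cancel. -/
lemma curl_chartField (hf : IsRegularSurface f)
    (hΦ : ContMDiff (𝓡∂ 2) 𝓘(ℝ, V) 1 Φ) {u : E2} (hu : u ∈ (extChartAt (𝓡∂ 2) x).target) :
    fderivWithin ℝ (chartField op f Φ x 1) halfPlane u (EuclideanSpace.single 0 1) -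
      fderivWithin ℝ (chartField op f Φ x 0) halfPlane u (EuclideanSpace.single 1 1) =
    op (partialDeriv x f u 1) (partialDeriv x Φ u 0) -
      op (partialDeriv x f u 0) (partialDeriv x Φ u 1) := by
  have huH := extChartAt_target_subset_range x hu
  -- Symmetry holds even on the edge, since every point of the half-plane is in the closure of its
  -- interior.
  have hsymm : IsSymmSndFDerivWithinAt ℝ (f ∘ (extChartAt (𝓡∂ 2) x).symm) halfPlane u :=
    (contDiffWithinAt_comp_symm (m := 2) (hf.smooth.of_le (by exact_mod_cast le_top))
      x hu).isSymmSndFDerivWithinAt (by simp) uniqueDiffOn_halfPlane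
      ((𝓡∂ 2).range_subset_closure_interior huH) huH
  rw [fderivWithin_chartField hf hΦ hu, fderivWithin_chartField hf hΦ hu,
    hsymm (EuclideanSpace.single 0 1) (EuclideanSpace.single 1 1)]
  abel

end

variable [IsManifold (𝓡∂ 2) ∞ M] [CompactSpace M] [MeasurableSpace M] [BorelSpace M] [FiniteDimensional ℝ V]
  [FiniteDimensional ℝ W]

lemma integrable_crossNablaOp (hf : IsRegularSurface f) (hn : IsUnitNormal f n)
    (op : E3 →ₗ[ℝ] V →ₗ[ℝ] W) {Φ : M → V} (hΦ : ContMDiff (𝓡∂ 2) 𝓘(ℝ, V) 1 Φ) :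
    Integrable (crossNablaOp f n op Φ) (areaMeasure f) := by
  have := isFiniteMeasure_areaMeasure hf
  have := FiniteDimensional.proper ℝ W
  have hc := continuous_crossNablaOp hf hn op hΦ
  obtain ⟨C, hC⟩ := isCompact_univ.exists_bound_of_continuousOn hc.continuousOn
  exact Integrable.of_bound hc.aestronglyMeasurable C
    (Filter.Eventually.of_forall fun z => hC z (mem_univ z))

lemma integrable_tangent_op (hf : IsRegularSurface f) (hn : IsUnitNormal f n)
    (hτ : IsBoundaryTangent f n τ) (op : E3 →ₗ[ℝ] V →ₗ[ℝ] W) {Φ : M → V} (hΦ : Continuous Φ) :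
    Integrable (fun z => op (τ z) (Φ z)) (lengthMeasure f) := by
  have := isFiniteMeasure_lengthMeasure hf
  have := FiniteDimensional.proper ℝ W
  have hB := (𝓡∂ 2).isClosed_boundary (M := M) (n := ∞) (by simp)
  have hc : ContinuousOn (fun z => op (τ z) (Φ z)) ((𝓡∂ 2).boundary M) :=
    op.continuous_uncurried.comp_continuousOn
      ((continuousOn_tangent hf hn hτ).prodMk hΦ.continuousOn)
  obtain ⟨C, hC⟩ := hB.isCompact.exists_bound_of_continuousOn hc
  rw [← lengthMeasure_restrict_boundary]
  exact Integrable.of_bound (hc.aestronglyMeasurable hB.measurableSet) C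
    ((ae_restrict_mem hB.measurableSet).mono hC)

/-- Stokes' formula for a field supported in a chart domain, on a part of constant orientation. -/
lemma stokes_of_tsupport_subset (hf : IsRegularSurface f) (hn : IsUnitNormal f n)
    (hτ : IsBoundaryTangent f n τ) (op : E3 →ₗ[ℝ] V →ₗ[ℝ] W) {Φ : M → V}
    (hΦ : ContMDiff (𝓡∂ 2) 𝓘(ℝ, V) 1 Φ) {x : M} {σ : ℝ}
    (hs : tsupport Φ ⊆ (extChartAt (𝓡∂ 2) x).source)
    (hσ : ∀ z ∈ tsupport Φ, chartSign f n x z = σ) :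
    ∫ z, op (τ z) (Φ z) ∂(lengthMeasure f) = ∫ z, crossNablaOp f n op Φ z ∂(areaMeasure f) := by
  set h := chartField op.toContinuousBilin f Φ x with hh
  have hcd : ∀ l, ContDiffOn ℝ 1 (h l) halfPlane := contDiffOn_chartField hf hΦ hs
  obtain ⟨R, hR0, hR⟩ : ∃ R > 0, extChartAt (𝓡∂ 2) x '' tsupport Φ ⊆ Metric.ball 0 R :=
    (isCompact_image_tsupport hs).isBounded.subset_ball_lt 0 0 |>.imp fun R h => ⟨h.1, h.2⟩
  have hbd : ∀ l, ∀ u ∈ halfPlane, R ≤ ‖u‖ → h l u = 0 := fun l u _ hRu =>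
    chartField_eq_zero (fun hu => absurd (mem_ball_zero_iff.1 (hR hu)) (not_lt.2 hRu)) l
  have hgreen := integral_halfPlane_curl (hcd 0) (hcd 1) hR0 (hbd 0) (hbd 1)
  have hvan : ∀ z ∉ (extChartAt (𝓡∂ 2) x).source, z ∉ tsupport Φ := fun z hz h => hz (hs h)
  rw [integral_lengthMeasure_eq hf x (integrable_tangent_op hf hn hτ op
      hΦ.continuous).aestronglyMeasurable fun z hz => by
      rw [image_eq_zero_of_notMem_tsupport (hvan z hz), map_zero],
    integral_areaMeasure_eq hf x (integrable_crossNablaOp hf hn op hΦ).aestronglyMeasurable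
      fun z hz => crossNablaOp_eq_zero_of_notMem_tsupport op (hvan z hz)]
  -- On the support |g_1| τ = −σ g_1; off it both integrands vanish.
  have hleft : ∫ t in edgeDomain x, ‖partialDeriv x f !₂[0, t] 1‖ •
      op (τ (edgeCurve x t)) (Φ (edgeCurve x t)) = ∫ t : ℝ, -(σ • h 1 !₂[0, t]) := by
    rw [← integral_indicator (measurableSet_edgeDomain x)]
    refine integral_congr_ae (Filter.Eventually.of_forall fun t => ?_)
    by_cases ht : t ∈ edgeDomain x
    · have hval : h 1 !₂[0, t] = op (partialDeriv x f !₂[0, t] 1) (Φ (edgeCurve x t)) := by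
        rw [hh, chartField, indicator_of_mem (show !₂[0, t] ∈ (extChartAt (𝓡∂ 2) x).target from ht)]
        rfl
      simp only [indicator_of_mem ht, hval]
      by_cases hz : edgeCurve x t ∈ tsupport Φ
      · have e := norm_smul_tangent_eq hf hn hτ (edgeCurve_mem_source ht)
          (edgeCurve_mem_boundary ht)
        rw [hσ _ hz] at e
        simp only [tangentVec, extChartAt_edgeCurve ht] at e
        rw [← LinearMap.smul_apply, ← map_smul, e]
        simp
      · simp [image_eq_zero_of_notMem_tsupport hz]
    · have hval : h 1 !₂[0, t] = 0 := by
        rw [hh, chartField, indicator_of_notMem (show !₂[0, t] ∉ (extChartAt (𝓡∂ 2) x).target from ht)]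
      simp [indicator_of_notMem ht, hval]
  -- The area density cancels the denominator in `crossNablaOp_eq`, leaving σ times the curl;
  -- outside the coordinate domain the curl is zero.
  have hright : ∫ u in (extChartAt (𝓡∂ 2) x).target,
      ‖cross (partialDeriv x f u 0) (partialDeriv x f u 1)‖ •
        crossNablaOp f n op Φ ((extChartAt (𝓡∂ 2) x).symm u) =
      ∫ u in halfPlane, σ • (fderivWithin ℝ (h 1) halfPlane u (EuclideanSpace.single 0 1) -
        fderivWithin ℝ (h 0) halfPlane u (EuclideanSpace.single 1 1)) := by
    refine Eq.trans ?_ (setIntegral_eq_of_subset_of_forall_sdiff_eq_zero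
      isClosed_halfPlane.measurableSet (extChartAt_target_subset_range x) ?_).symm
    · refine setIntegral_congr_fun (measurableSet_extChartAt_target x) fun u hu => ?_
      have hzx := (extChartAt (𝓡∂ 2) x).map_target hu
      simp only [hh]
      rw [curl_chartField hf hΦ hu, crossNablaOp_eq hf hn op hΦ hzx]
      simp only [LinearMap.toContinuousBilin_apply]
      by_cases hz : (extChartAt (𝓡∂ 2) x).symm u ∈ tsupport Φ
      · have hne := norm_ne_zero_iff.2 (cross_tangentVec_ne_zero hf hzx)
        rw [hσ _ hz]
        simp only [tangentVec, (extChartAt (𝓡∂ 2) x).right_inv hu] at hne ⊢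
        rw [smul_smul, mul_div_cancel₀ _ hne]
      · have h0 := tangentVec_eq_zero_of_notMem_tsupport hzx hz
        simp only [tangentVec, (extChartAt (𝓡∂ 2) x).right_inv hu] at h0 ⊢
        simp [h0]
    · rintro u ⟨huH, hu⟩
      have h0 : ∀ l, fderivWithin ℝ (h l) halfPlane u = 0 := fun l => by
        rw [((chartField_eventuallyEq_zero hs hu l).filter_mono
          nhdsWithin_le_nhds).fderivWithin_eq_of_mem huH]
        simp
      simp [h0]
  rw [hleft, hright, integral_smul, hgreen, integral_neg, integral_smul, smul_neg]

end

/-! ### Globalization by a partition of unity. -/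

section

variable {M : Type*} [TopologicalSpace M] [ChartedSpace (EuclideanHalfSpace 2) M]
  [IsManifold (𝓡∂ 2) ∞ M]
  {V : Type*} [NormedAddCommGroup V] [NormedSpace ℝ V]
  {W : Type*} [NormedAddCommGroup W] [NormedSpace ℝ W] {f n τ : M → E3}

lemma crossNablaOp_sum {ι : Type*} [Fintype ι] (op : E3 →ₗ[ℝ] V →ₗ[ℝ] W) {Φ : ι → M → V}
    (hΦ : ∀ i, ContMDiff (𝓡∂ 2) 𝓘(ℝ, V) 1 (Φ i)) (z : M) :
    crossNablaOp f n op (fun y => ∑ i, Φ i y) z = ∑ i, crossNablaOp f n op (Φ i) z := by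
  have h : ∀ l, partialAt (fun y => ∑ i, Φ i y) z l = ∑ i, partialAt (Φ i) z l := by
    intro l
    have hd : ∀ i ∈ Finset.univ, DifferentiableWithinAt ℝ
        (Φ i ∘ (extChartAt (𝓡∂ 2) z).symm) halfPlane (extChartAt (𝓡∂ 2) z z) :=
      fun i _ => differentiableWithinAt_comp_symm (hΦ i) z (mem_extChartAt_target z)
    have hs := fderivWithin_fun_sum
      (uniqueDiffOn_halfPlane _ (extChartAt_mem_halfPlane z z)) hd
    refine (congrArg (fun L : E2 →L[ℝ] V => L (EuclideanSpace.single l 1)) hs).trans ?_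
    rw [sum_apply]
    rfl
  simp only [crossNablaOp, h, map_sum]
  exact Finset.sum_comm

/-- A chart domain may be disconnected and carry both orientations; this is the piece oriented as at
the centre `x`. -/
lemma isOpen_setOf_chartSign (hf : IsRegularSurface f) (hn : IsUnitNormal f n) (x : M) :
    IsOpen ((extChartAt (𝓡∂ 2) x).source ∩
      {z | 0 < chartSign f n x z * chartSign f n x x}) :=
  ((continuousOn_chartSign hf hn x).mul continuousOn_const).isOpen_inter_preimage
    (isOpen_extChartAt_source x) isOpen_Ioi

lemma chartSign_eq_of_mul_pos (hf : IsRegularSurface f) (hn : IsUnitNormal f n) {x z : M}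
    (hx : z ∈ (extChartAt (𝓡∂ 2) x).source)
    (h : 0 < chartSign f n x z * chartSign f n x x) : chartSign f n x z = chartSign f n x x := by
  rcases (abs_eq zero_le_one).1 (abs_chartSign hf hn hx) with h1 | h1 <;>
  rcases (abs_eq zero_le_one).1 (abs_chartSign hf hn (mem_extChartAt_source x)) with h2 | h2 <;>
  rw [h1, h2] at h ⊢ <;> norm_num at h

/-- Stokes' formula for operations with the tangent vector as first factor. -/
theorem stokes_crossNablaOp [T2Space M] [CompactSpace M] [MeasurableSpace M] [BorelSpace M]
    [FiniteDimensional ℝ V] [FiniteDimensional ℝ W] (hf : IsRegularSurface f)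
    (hn : IsUnitNormal f n) (hτ : IsBoundaryTangent f n τ) (op : E3 →ₗ[ℝ] V →ₗ[ℝ] W)
    {Φ : M → V} (hΦ : ContMDiff (𝓡∂ 2) 𝓘(ℝ, V) 1 Φ) :
    ∫ z, op (τ z) (Φ z) ∂(lengthMeasure f) = ∫ z, crossNablaOp f n op Φ z ∂(areaMeasure f) := by
  set U : M → Set M := fun x => (extChartAt (𝓡∂ 2) x).source ∩
      {z | 0 < chartSign f n x z * chartSign f n x x} with hU
  have hUo : ∀ x, IsOpen (U x) := isOpen_setOf_chartSign hf hn
  have hUx : ∀ x, x ∈ U x := fun x => by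
    refine ⟨mem_extChartAt_source x, ?_⟩
    change 0 < chartSign f n x x * chartSign f n x x
    refine mul_self_pos.2 fun h => ?_
    have := abs_chartSign hf hn (mem_extChartAt_source x)
    rw [h] at this
    simp at this
  -- With a finite index set the sum of the partition commutes with integrals and derivatives.
  obtain ⟨t, ht⟩ := isCompact_univ.elim_nhds_subcover U fun x _ => (hUo x).mem_nhds (hUx x)
  obtain ⟨ρ, hρ⟩ := SmoothPartitionOfUnity.exists_isSubordinate (𝓡∂ 2) isClosed_univ
    (fun i : t => U i) (fun i => hUo i) fun z hz => by
      obtain ⟨i, hi, hzi⟩ := mem_iUnion₂.1 (ht.2 hz)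
      exact mem_iUnion.2 ⟨⟨i, hi⟩, hzi⟩
  set Ψ : t → M → V := fun i z => ρ i z • Φ z with hΨ
  have hΨC : ∀ i, ContMDiff (𝓡∂ 2) 𝓘(ℝ, V) 1 (Ψ i) := fun i =>
    ((ρ i).contMDiff.of_le (by exact_mod_cast le_top)).smul hΦ
  have hsum : Φ = fun z => ∑ i, Ψ i z := by
    funext z
    have := ρ.sum_eq_one (mem_univ z)
    rw [finsum_eq_sum_of_fintype] at this
    rw [← Finset.sum_smul, this, one_smul]
  have hsupp : ∀ i, tsupport (Ψ i) ⊆ U i := fun i =>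
    (tsupport_smul_subset_left (ρ i) Φ).trans (hρ i)
  have hloc : ∀ i, ∫ z, op (τ z) (Ψ i z) ∂(lengthMeasure f) =
      ∫ z, crossNablaOp f n op (Ψ i) z ∂(areaMeasure f) := fun i =>
    stokes_of_tsupport_subset hf hn hτ op (hΨC i) (σ := chartSign f n i i)
      ((hsupp i).trans inter_subset_left) fun z hz =>
        chartSign_eq_of_mul_pos hf hn (hsupp i hz).1 (hsupp i hz).2
  calc ∫ z, op (τ z) (Φ z) ∂(lengthMeasure f)
      = ∫ z, ∑ i, op (τ z) (Ψ i z) ∂(lengthMeasure f) := by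
        conv_lhs => rw [hsum]
        simp only [map_sum]
    _ = ∑ i, ∫ z, op (τ z) (Ψ i z) ∂(lengthMeasure f) :=
        integral_finsetSum _ fun i _ => integrable_tangent_op hf hn hτ op (hΨC i).continuous
    _ = ∑ i, ∫ z, crossNablaOp f n op (Ψ i) z ∂(areaMeasure f) :=
        Finset.sum_congr rfl fun i _ => hloc i
    _ = ∫ z, ∑ i, crossNablaOp f n op (Ψ i) z ∂(areaMeasure f) :=
        (integral_finsetSum _ fun i _ => integrable_crossNablaOp hf hn op (hΨC i)).symm
    _ = ∫ z, crossNablaOp f n op Φ z ∂(areaMeasure f) := by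
        conv_rhs => rw [hsum]
        simp only [crossNablaOp_sum op hΨC]

end

/-- Finite dimension makes every bilinear operation on tensors continuous. -/
lemma finiteDimensional_tensor (p : ℕ) : FiniteDimensional ℝ (Tensor p) :=
  FiniteDimensional.of_injective
    (ContinuousMultilinearMap.toMultilinearMapLinear : Tensor p →ₗ[ℝ]
      MultilinearMap ℝ (fun _ : Fin p => E3) ℝ)
    ContinuousMultilinearMap.toMultilinearMap_injective

end Surface

end

/-- Generalized Stokes formulas of the first kind, for a compact smooth surface `M` with (possibly
empty) smooth boundary, with position vector `f` in `ℝ³`, and a tensor field `Φ` on the surface.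
The operation `op` is any bilinear operation between vectors and tensors: any tensor product or
contraction, or a vector product. -/
theorem proposition1
    {M : Type*} [TopologicalSpace M] [T2Space M] [CompactSpace M]
    [ChartedSpace (EuclideanHalfSpace 2) M] [IsManifold (𝓡∂ 2) ∞ M]
    [MeasurableSpace M] [BorelSpace M]
    (f n τ : M → E3)
    (hf : Surface.IsRegularSurface f)
    (hn : Surface.IsUnitNormal f n)
    (hτ : Surface.IsBoundaryTangent f n τ)
    (p : ℕ) (Φ : M → Tensor p) (hΦ : ContMDiff (𝓡∂ 2) 𝓘(ℝ, Tensor p) 1 Φ)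
    {W : Type*} [NormedAddCommGroup W] [NormedSpace ℝ W] [FiniteDimensional ℝ W] :
    (∀ op : E3 →ₗ[ℝ] Tensor p →ₗ[ℝ] W,
      Integrable (fun x => op (τ x) (Φ x)) (Surface.lengthMeasure f) ∧
      Integrable (Surface.crossNablaOp f n op Φ) (Surface.areaMeasure f) ∧
      ∫ x, op (τ x) (Φ x) ∂(Surface.lengthMeasure f) =
        ∫ x, Surface.crossNablaOp f n op Φ x ∂(Surface.areaMeasure f)) ∧
    (∀ op : Tensor p →ₗ[ℝ] E3 →ₗ[ℝ] W,
      Integrable (fun x => op (Φ x) (τ x)) (Surface.lengthMeasure f) ∧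
      Integrable (Surface.opCrossNabla f n op Φ) (Surface.areaMeasure f) ∧
      ∫ x, op (Φ x) (τ x) ∂(Surface.lengthMeasure f) =
        ∫ x, Surface.opCrossNabla f n op Φ x ∂(Surface.areaMeasure f)) := by
  have := Surface.finiteDimensional_tensor p
  have key : ∀ op : E3 →ₗ[ℝ] Tensor p →ₗ[ℝ] W,
      Integrable (fun x => op (τ x) (Φ x)) (Surface.lengthMeasure f) ∧
      Integrable (Surface.crossNablaOp f n op Φ) (Surface.areaMeasure f) ∧
      ∫ x, op (τ x) (Φ x) ∂(Surface.lengthMeasure f) =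
        ∫ x, Surface.crossNablaOp f n op Φ x ∂(Surface.areaMeasure f) := fun op =>
    ⟨Surface.integrable_tangent_op hf hn hτ op hΦ.continuous,
      Surface.integrable_crossNablaOp hf hn op hΦ, Surface.stokes_crossNablaOp hf hn hτ op hΦ⟩
  -- Flipping the arguments of the operation turns the second formula into the first, by definition.
  exact ⟨key, fun op => key op.flip⟩
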